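/- Let $\alpha\in(0,1]$ and $\mathbb I_\alpha=[\alpha-1,\alpha]$. For $x\in\mathbb I_\alpha\setminus\{0\}$ put $d_\alpha(x)=\lfloor |1/x|+1-\alpha\rfloor$, $\varepsilon(x)=+1$ if $x>0$ and $\varepsilon(x)=-1$ if $x<0$, and define $T_\alpha(x)=|1/x|-d_\alpha(x)$ and, for $y\in[0,1]$, $\mathcal T_\alpha(x,y)=\bigl(T_\alpha(x),\,1/(d_\alpha(x)+\varepsilon(x)y)\bigr)$; moreover $T_\alpha(0)=0$ and $\mathcal T_\alpha(0,y)=(0,0)$. Let $\Omega_\alpha$ be the closure of $\{\mathcal T_\alpha^n(x,0) : x\in[\alpha-1,\alpha),\ n\ge 0\}$, which is a subset of $\mathbb I_\alpha\times[0,1]$, and let $\mu$ be the measure with density $(1+xy)^{-2}$ with respect to Lebesgue measure $dx\,dy$. Then $0<\mu(\Omega_\alpha)<\infty$, and $\mathcal T_\alpha$ maps $\mu$-almost every point of $\Omega_\alpha$ into $\Omega_\alpha$. Let $\mu_\alpha=\mu|_{\Omega_\alpha}/\mu(\Omega_\alpha)$, let $\nu_\alpha$ be its marginal on $\mathbb I_\alpha$,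 that is, the measure with density $x\mapsto \mu(\Omega_\alpha)^{-1}\int_{\{y:(x,y)\in\Omega_\alpha\}}(1+xy)^{-2}\,dy$, let $\mathscr B_\alpha'$ and $\mathscr B_\alpha$ be the Borel $\sigma$-algebras of $\Omega_\alpha$ and $\mathbb I_\alpha$, and let $\pi(x,y)=x$. Then $(\Omega_\alpha,\mathcal T_\alpha,\mathscr B_\alpha',\mu_\alpha)$ is, through $\pi$, a natural extension of $(\mathbb I_\alpha,T_\alpha,\mathscr B_\alpha,\nu_\alpha)$. This means: $T_\alpha$ preserves the probability measure $\nu_\alpha$; $\pi:\Omega_\alpha\to\mathbb I_\alpha$ is surjective and measurable with $\pi_*\mu_\alpha=\nu_\alpha$, and $\pi\circ\mathcal T_\alpha=T_\alpha\circ\pi$ $\mu_\alpha$-almost everywhere; $\mathcal T_\alpha$ preserves $\mu_\alpha$ and is invertible modulo null sets with a measurable, $\mu_\alpha$-preserving inverse; and the extension is minimal, that is, $\mathscr B_\alpha'=\bigvee_{n\ge0}\mathcal T_\alpha^n\pi^{-1}\mathscr B_\alpha$ modulo null sets, and for every probability-preserving system $(Z,U,\rho)$ that is invertible modulo null sets and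 every factor map $\psi$ from it to $(\mathbb I_\alpha,T_\alpha,\mathscr B_\alpha,\nu_\alpha)$ there is a factor map $\varphi$ from $(Z,U,\rho)$ to $(\Omega_\alpha,\mathcal T_\alpha,\mathscr B_\alpha',\mu_\alpha)$ with $\pi\circ\varphi=\psi$ $\rho$-almost everywhere. (A factor map is a measurable map that carries the one measure to the other and intertwines the transformations almost everywhere.) -/

import Mathlib

open MeasureTheory Set

universe u v w

/-! ## Measure-preserving systems, factors, natural extensions

All statements about dynamical systems on probability spaces are modulo null sets, as usual. -/

/-- `S` is invertible (modulo null sets) as a transformation of `(X, μ)` with inverse `R`: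
both maps preserve `μ` and they are inverse to each other almost everywhere. -/
structure IsAEInverse {X : Type u} [MeasurableSpace X] (μ : Measure X) (S R : X → X) : Prop where
  measurePreserving : MeasurePreserving S μ μ
  measurePreserving_inv : MeasurePreserving R μ μ
  left_inv : ∀ᵐ x ∂μ, R (S x) = x
  right_inv : ∀ᵐ x ∂μ, S (R x) = x

/-- `π` exhibits `(Y, T, ν)` as a factor of `(X, S, μ)`. Since `π` carries `μ` to `ν`, it is
automatically surjective in the measure-theoretic sense (a measurable set that contains its image
has full measure). -/
structure IsFactorMap {X : Type u} {Y : Type v} [MeasurableSpace X] [MeasurableSpace Y]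
    (S : X → X) (μ : Measure X) (T : Y → Y) (ν : Measure Y) (π : X → Y) : Prop where
  measurePreserving : MeasurePreserving π μ ν
  semiconj : ∀ᵐ x ∂μ, π (S x) = T (π x)

/-- The probability-preserving system `(X, S, μ)` is, through the map `π : X → Y`, a natural
extension of the probability-preserving system `(Y, T, ν)`: it is an invertible extension of it,
the factor map is surjective, and it is the minimal such extension. Minimality is
required in both of its customary forms: the sets that are measurable with respect to the join of
the σ-algebras `S^n π⁻¹ 𝓑(Y)`, `n ≥ 0`, exhaust the measurable sets of `X` up to null sets
(field `generates`), and every invertible extension of `(Y, T, ν)` factors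
through `π` (field `universal`). -/
structure IsNaturalExtension {X : Type u} {Y : Type v} [MeasurableSpace X] [MeasurableSpace Y]
    (S : X → X) (μ : Measure X) (T : Y → Y) (ν : Measure Y) (π : X → Y) : Prop where
  prob_top : IsProbabilityMeasure μ
  prob_base : IsProbabilityMeasure ν
  base : MeasurePreserving T ν ν
  surjective : Function.Surjective π
  factor : IsFactorMap S μ T ν π
  generates : ∃ R : X → X, IsAEInverse μ S R ∧
    ∀ A : Set X, MeasurableSet A → ∃ B : Set X,
      MeasurableSet[⨆ n : ℕ, MeasurableSpace.comap (fun x => π (R^[n] x)) inferInstance] B ∧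
        B =ᵐ[μ] A
  universal : ∀ (Z : Type w) [MeasurableSpace Z] (ρ : Measure Z) [IsProbabilityMeasure ρ]
    (U V : Z → Z) (ψ : Z → Y), IsAEInverse ρ U V → IsFactorMap U ρ T ν ψ →
      ∃ φ : Z → X, IsFactorMap U ρ S μ φ ∧ ∀ᵐ z ∂ρ, π (φ z) = ψ z

namespace AlphaCF

/-! ## The `α`-continued fraction map and its planar extension -/

/-- The interval `𝕀_α = [α - 1, α]`. -/
def interval (α : ℝ) : Set ℝ := Icc (α - 1) α

/-- The digit `d_α(x) = ⌊|1/x| + 1 - α⌋`, for `x ≠ 0` (never used at `0`, where `d_α = ∞`). -/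
noncomputable def digit (α x : ℝ) : ℤ := ⌊|1 / x| + 1 - α⌋

/-- The sign `ε(x)`, equal to `+1` for `x ≥ 0` and to `-1` for `x < 0`. -/
noncomputable def sgn (x : ℝ) : ℝ := if 0 ≤ x then 1 else -1

/-- The map `T_α(x) = |1/x| - ⌊|1/x| + 1 - α⌋` for `x ≠ 0`, `T_α(0) = 0`. -/
noncomputable def map (α x : ℝ) : ℝ := if x = 0 then 0 else |1 / x| - digit α x

/-- The planar map `𝒯_α(x, y) = (T_α(x), 1 / (d_α(x) + ε(x) y))`, where the second
coordinate is `0` if `x = 0` (because `d_α(0) = ∞`). -/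
noncomputable def planarMap (α : ℝ) (p : ℝ × ℝ) : ℝ × ℝ :=
  (map α p.1, if p.1 = 0 then 0 else 1 / (digit α p.1 + sgn p.1 * p.2))

/-- `Ω_α`, the closure of the set of all `𝒯_α^n(x, 0)` with `x ∈ [α - 1, α)` and `n ≥ 0`. -/
def domain (α : ℝ) : Set (ℝ × ℝ) :=
  closure {p | ∃ x ∈ Ico (α - 1) α, ∃ n : ℕ, p = (planarMap α)^[n] (x, 0)}

/-- The measure `μ` with density `(1 + xy)⁻²` with respect to Lebesgue measure. -/
noncomputable def planeMeasure : Measure (ℝ × ℝ) :=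
  volume.withDensity fun p => ENNReal.ofReal (1 / (1 + p.1 * p.2) ^ 2)

/-! ## The two systems, on the spaces `𝕀_α` and `Ω_α` with their Borel σ-algebras -/

theorem map_mapsTo {α : ℝ} (hα : α ∈ Ioc (0 : ℝ) 1) :
    MapsTo (map α) (interval α) (interval α) := by
  intro x _
  obtain ⟨h0, h1⟩ := hα
  unfold map interval
  split_ifs with hx
  · constructor <;> linarith
  · have := Int.floor_le (|1 / x| + 1 - α)
    have := Int.lt_floor_add_one (|1 / x| + 1 - α)
    unfold digit
    constructor <;> linarith

theorem one_le_denom {α : ℝ} (hα : α ∈ Ioc (0 : ℝ) 1) {x y : ℝ} (hx : x ∈ interval α)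
    (hx0 : x ≠ 0) (hy : y ∈ Icc (0 : ℝ) 1) : 1 ≤ (digit α x : ℝ) + sgn x * y := by
  obtain ⟨h0, h1⟩ := hα
  obtain ⟨hx1, hx2⟩ := hx
  obtain ⟨hy0, hy1⟩ := hy
  have hpos : 0 < |x| := abs_pos.mpr hx0
  unfold digit sgn
  rw [abs_div, abs_one]
  split_ifs with hs
  · have h : (1 : ℝ) ≤ 1 / |x| := by
      rw [le_div_iff₀ hpos, abs_of_nonneg hs]; linarith
    have : (1 : ℤ) ≤ ⌊1 / |x| + 1 - α⌋ := by
      rw [Int.le_floor]; push_cast; linarith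
    have : (1 : ℝ) ≤ (⌊1 / |x| + 1 - α⌋ : ℝ) := by exact_mod_cast this
    linarith
  · have h : 1 + α ≤ 1 / |x| := by
      rw [le_div_iff₀ hpos, abs_of_neg (not_le.mp hs)]; nlinarith
    have : (2 : ℤ) ≤ ⌊1 / |x| + 1 - α⌋ := by
      rw [Int.le_floor]; push_cast; linarith
    have : (2 : ℝ) ≤ (⌊1 / |x| + 1 - α⌋ : ℝ) := by exact_mod_cast this
    linarith

theorem planarMap_mapsTo {α : ℝ} (hα : α ∈ Ioc (0 : ℝ) 1) :
    MapsTo (planarMap α) (interval α ×ˢ Icc 0 1) (interval α ×ˢ Icc 0 1) := by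
  rintro ⟨x, y⟩ ⟨hx, hy⟩
  refine ⟨map_mapsTo hα hx, ?_⟩
  simp only [planarMap]
  split_ifs with h0
  · simp
  · have h := one_le_denom hα hx h0 hy
    exact ⟨by positivity, by rw [div_le_one (by linarith)]; exact h⟩

theorem domain_subset {α : ℝ} (hα : α ∈ Ioc (0 : ℝ) 1) :
    domain α ⊆ interval α ×ˢ Icc 0 1 := by
  refine closure_minimal ?_ (isClosed_Icc.prod isClosed_Icc)
  rintro p ⟨x, hx, n, rfl⟩
  exact (planarMap_mapsTo hα).iterate n ⟨Ico_subset_Icc_self hx, by simp⟩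

/-- `T_α` as a self-map of `𝕀_α`. -/
noncomputable def intervalMap {α : ℝ} (hα : α ∈ Ioc (0 : ℝ) 1) : interval α → interval α :=
  (map_mapsTo hα).restrict

open Classical in
/-- `𝒯_α` as a self-map of `Ω_α`. A point that `𝒯_α` would move out of `Ω_α` (which can happen on
discontinuity lines of `𝒯_α`) stays where it is. -/
noncomputable def domainMap (α : ℝ) (p : domain α) : domain α :=
  if h : planarMap α p ∈ domain α then ⟨planarMap α p, h⟩ else p

/-- The projection `π : Ω_α → 𝕀_α` to the first coordinate. -/
def proj {α : ℝ} (hα : α ∈ Ioc (0 : ℝ) 1) (p : domain α) : interval α :=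
  ⟨p.1.1, (domain_subset hα p.2).1⟩

/-- `μ_α`, the measure `μ` on `Ω_α` divided by its total mass `μ(Ω_α)`. -/
noncomputable def domainMeasure (α : ℝ) : Measure (domain α) :=
  (planeMeasure (domain α))⁻¹ • planeMeasure.comap Subtype.val

/-- `ν_α`, the marginal measure on `𝕀_α`: its density at `x` is the integral of the density of
`μ_α` over the fibre `{y | (x, y) ∈ Ω_α}`. -/
noncomputable def intervalMeasure (α : ℝ) : Measure (interval α) :=
  (volume.withDensity fun x : ℝ => (planeMeasure (domain α))⁻¹ *
    ∫⁻ y in {y : ℝ | (x, y) ∈ domain α}, ENNReal.ofReal (1 / (1 + x * y) ^ 2)).comap Subtype.val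

end AlphaCF

/-! The proof has three ingredients.

Positivity of the measure. The height of `𝒯_α^n (x, 0)` is `q' / q`, a quotient of consecutive
denominators of convergents of `x` (`iterate_snd_eq`). Fix a large `N`. Outside a set of measure at
most `1/2`, some denominator of `x` lies in `[N, 20 N / α]` (`volume_jump_le`). The points `x` with
consecutive denominators `q', q` are images of the horizontal section of `Ω_α` at height `q' / q`
under at most 14 Möbius maps that contract by `1 / (α q)^2` (`volume_denSet_le`). Hence the sections
at these heights have total length at least a constant times `N^2`. The heights are fractions with
bounded denominators, so they are separated by a constant over `N^2`; thickening the sections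
vertically gives disjoint sets whose area is bounded below independently of `N`
(`le_volume_thickening`). As `N` grows, the thickenings shrink to the closed set `Ω_α`.

Invertibility. `𝒯_α` is continuous off countably many vertical lines, so it maps almost all of `Ω_α`
into `Ω_α`; near a point of positive height only finitely many branches matter, so it also covers
almost all of `Ω_α` (`exists_planarMap_eq`). Each branch preserves `μ`. The number of preimages is
therefore at least 1 almost everywhere and has integral `μ(Ω_α) < ∞`, so it is 1 almost everywhere
(`ae_multiplicity_eq_one`). Invariance of `μ` and injectivity modulo null sets both follow.

Minimality. The denominators tend to infinity uniformly in irrational `x`, so the height of `𝒯_α^n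
(x, y)` forgets `y` uniformly (`exists_abs_iterate_snd_sub_le`). A backward orbit of `T_α` thus
determines a point of `Ω_α`, and almost every point of `Ω_α` is recovered from its own past: this is
generation. In any invertible extension, sending a point to the limit point of its past gives the
required factor map. Its law is a weak limit depending only on `ν_α`, and comparison with the
extension `Ω_α` itself identifies that law as `μ_α` (`map_limitPoint_past`). -/

namespace AlphaCF

/-! ## Orbits and continuants -/

/-- The sign `ε(x)` as an integer. -/
noncomputable def intSgn (x : ℝ) : ℤ := if 0 ≤ x then 1 else -1

theorem intSgn_cast (x : ℝ) : (intSgn x : ℝ) = sgn x := by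
  unfold intSgn sgn; split_ifs <;> simp

theorem sgn_mul_self (x : ℝ) : sgn x * sgn x = 1 := by
  unfold sgn; split_ifs <;> norm_num

theorem sgn_mul_abs (x : ℝ) : sgn x * |x| = x := by
  unfold sgn
  split_ifs with h
  · rw [abs_of_nonneg h, one_mul]
  · rw [abs_of_neg (not_le.mp h)]; ring

theorem digit_add_map {α x : ℝ} (hx : x ≠ 0) : (digit α x : ℝ) + map α x = |1 / x| := by
  simp [map, hx]

theorem eq_sgn_div {α x : ℝ} (hx : x ≠ 0) : x = sgn x / (digit α x + map α x) := by
  rw [digit_add_map hx, abs_div, abs_one, div_div_eq_mul_div, div_one, sgn_mul_abs]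

theorem one_le_digit {α : ℝ} (hα : α ∈ Ioc (0 : ℝ) 1) {x : ℝ} (hx : x ∈ interval α)
    (hx0 : x ≠ 0) : 1 ≤ digit α x := by
  have := one_le_denom hα hx hx0 (y := 0) (by simp)
  simp only [mul_zero, add_zero] at this
  exact_mod_cast this

theorem irrational_map {α x : ℝ} (hx : Irrational x) : Irrational (map α x) := by
  have hx0 := hx.ne_zero
  simp only [map, hx0, if_false]
  apply Irrational.sub_intCast
  rcases abs_choice (1 / x) with h | h <;> rw [h]
  · simpa using hx.inv
  · simpa using hx.inv.neg

theorem irrational_iterate {α x : ℝ} (hx : Irrational x) (n : ℕ) :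
    Irrational ((map α)^[n] x) := by
  induction n with
  | zero => exact hx
  | succ n ih => rw [Function.iterate_succ_apply']; exact irrational_map ih

theorem iterate_mem {α : ℝ} (hα : α ∈ Ioc (0 : ℝ) 1) {x : ℝ} (hx : x ∈ interval α) (n : ℕ) :
    (map α)^[n] x ∈ interval α :=
  (map_mapsTo hα).iterate n hx

theorem planarMap_iterate_fst (α : ℝ) (n : ℕ) (p : ℝ × ℝ) :
    ((planarMap α)^[n] p).1 = (map α)^[n] p.1 := by
  induction n with
  | zero => rfl
  | succ n ih => rw [Function.iterate_succ_apply', Function.iterate_succ_apply', ← ih]; rfl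

theorem planarMap_iterate_snd_mem {α : ℝ} (hα : α ∈ Ioc (0 : ℝ) 1) {x y : ℝ}
    (hx : x ∈ interval α) (hy : y ∈ Icc (0 : ℝ) 1) (n : ℕ) :
    ((planarMap α)^[n] (x, y)).2 ∈ Icc (0 : ℝ) 1 :=
  ((planarMap_mapsTo hα).iterate n (show (x, y) ∈ interval α ×ˢ Icc 0 1 from ⟨hx, hy⟩)).2

/-- The solution of the recursion `c (n + 2) = d (T^n x) * c (n + 1) + ε (T^n x) * c n`
with `c 0 = a` and `c 1 = b`. -/
noncomputable def continuant (α x : ℝ) (a b : ℤ) : ℕ → ℤ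
  | 0 => a
  | 1 => b
  | n + 2 => digit α ((map α)^[n] x) * continuant α x a b (n + 1)
      + intSgn ((map α)^[n] x) * continuant α x a b n

/-- The denominators of the convergents, with index shifted by one. -/
noncomputable def den (α x : ℝ) : ℕ → ℤ := continuant α x 0 1

/-- The numerators of the convergents, with index shifted by one. -/
noncomputable def num (α x : ℝ) : ℕ → ℤ := continuant α x 1 0

@[simp] theorem den_zero (α x : ℝ) : den α x 0 = 0 := rfl
@[simp] theorem den_one (α x : ℝ) : den α x 1 = 1 := rfl
@[simp] theorem num_zero (α x : ℝ) : num α x 0 = 1 := rfl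
@[simp] theorem num_one (α x : ℝ) : num α x 1 = 0 := rfl

theorem den_add_two (α x : ℝ) (n : ℕ) : den α x (n + 2) =
    digit α ((map α)^[n] x) * den α x (n + 1) + intSgn ((map α)^[n] x) * den α x n := rfl

theorem num_add_two (α x : ℝ) (n : ℕ) : num α x (n + 2) =
    digit α ((map α)^[n] x) * num α x (n + 1) + intSgn ((map α)^[n] x) * num α x n := rfl

/-- Each step of the recursion multiplies the determinant by `-ε`, a unit. -/
theorem abs_det_eq_one (α x : ℝ) (n : ℕ) :
    |num α x n * den α x (n + 1) - num α x (n + 1) * den α x n| = 1 := by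
  induction n with
  | zero => simp
  | succ n ih =>
    have h : num α x (n + 1) * den α x (n + 2) - num α x (n + 2) * den α x (n + 1)
        = - intSgn ((map α)^[n] x) *
          (num α x n * den α x (n + 1) - num α x (n + 1) * den α x n) := by
      rw [den_add_two, num_add_two]; ring
    rw [h, abs_mul, ih, abs_neg, mul_one]
    unfold intSgn; split_ifs <;> simp

/-- The combinations `w n = den n + y * num n` obey the continuant recursion with `w 0 = y`, `w 1 =
1`, and the height after `n` steps is `w n / w (n + 1)`. The ratio of successive terms is the
denominator `d + ε t` of the planar map, which is at least 1. The case `y = 0` yields positivity and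
monotonicity of the denominators. -/
theorem iterate_snd_mul {α : ℝ} (hα : α ∈ Ioc (0 : ℝ) 1) {x y : ℝ} (hx : x ∈ interval α)
    (hi : Irrational x) (hy : y ∈ Icc (0 : ℝ) 1) (n : ℕ) :
    1 ≤ (den α x (n + 1) : ℝ) + y * num α x (n + 1) ∧
    ((planarMap α)^[n] (x, y)).2 * (den α x (n + 1) + y * num α x (n + 1))
      = den α x n + y * num α x n ∧
    (den α x n : ℝ) + y * num α x n ≤ den α x (n + 1) + y * num α x (n + 1) := by
  induction n with
  | zero => simp [hy.2]
  | succ n ih =>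
    obtain ⟨h1, h2, -⟩ := ih
    set z := (map α)^[n] x with hz
    set t := ((planarMap α)^[n] (x, y)).2 with ht
    have htm : t ∈ Icc (0 : ℝ) 1 := planarMap_iterate_snd_mem hα hx hy n
    have hz0 : z ≠ 0 := (irrational_iterate hi n).ne_zero
    have hd := one_le_denom hα (iterate_mem hα hx n) hz0 htm
    have hw : (den α x (n + 2) : ℝ) + y * num α x (n + 2)
        = (digit α z + sgn z * t) * (den α x (n + 1) + y * num α x (n + 1)) := by
      rw [den_add_two, num_add_two, ← hz, ← intSgn_cast]
      push_cast
      linear_combination (-(intSgn z : ℝ)) * h2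
    have hs : ((planarMap α)^[n + 1] (x, y)).2 = 1 / (digit α z + sgn z * t) := by
      rw [Function.iterate_succ_apply']
      have : ((planarMap α)^[n] (x, y)).1 = z := planarMap_iterate_fst α n (x, y)
      simp only [planarMap, this, hz0, if_false, ← ht]
    have hmono : (den α x (n + 1) : ℝ) + y * num α x (n + 1)
        ≤ (den α x (n + 2) : ℝ) + y * num α x (n + 2) := by
      rw [hw]; nlinarith
    refine ⟨h1.trans hmono, ?_, hmono⟩
    change _ * ((den α x (n + 2) : ℝ) + y * num α x (n + 2)) = _
    have hd' : (0 : ℝ) < digit α z + sgn z * t := by rw [hz]; linarith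
    rw [hs, hw, ← mul_assoc, one_div_mul_cancel hd'.ne', one_mul]

/-- This is the Möbius formula for `x` in terms of `T^n x`, with the denominator cleared; the
induction uses `z (d + T z) = ε`. -/
theorem mul_den_add {α x : ℝ} (hi : Irrational x) (n : ℕ) :
    x * (den α x (n + 1) + den α x n * (map α)^[n] x)
      = num α x (n + 1) + num α x n * (map α)^[n] x := by
  induction n with
  | zero => simp
  | succ n ih =>
    set z := (map α)^[n] x with hz
    have hz0 : z ≠ 0 := (irrational_iterate hi n).ne_zero
    have hs : (map α)^[n + 1] x = map α z := Function.iterate_succ_apply' ..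
    have hd : (0 : ℝ) < digit α z + map α z := by rw [digit_add_map hz0]; positivity
    have he : z * (digit α z + map α z) = intSgn z := by
      rw [intSgn_cast]; nth_rewrite 1 [eq_sgn_div (α := α) hz0]
      field_simp
    change x * ((den α x (n + 2) : ℝ) + den α x (n + 1) * _) = num α x (n + 2) + _
    rw [den_add_two, num_add_two, hs, ← hz]
    push_cast
    linear_combination (digit α z + map α z) * ih
      - (x * den α x n - num α x n) * he

section Irrational

variable {α : ℝ} (hα : α ∈ Ioc (0 : ℝ) 1) {x : ℝ} (hx : x ∈ interval α) (hi : Irrational x)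

include hα hx hi

theorem one_le_den (n : ℕ) : 1 ≤ den α x (n + 1) := by
  have := (iterate_snd_mul hα hx hi (y := 0) (by simp) n).1
  simp only [zero_mul, add_zero] at this
  exact_mod_cast this

theorem den_mono : Monotone (den α x) := by
  refine monotone_nat_of_le_succ fun n => ?_
  have := (iterate_snd_mul hα hx hi (y := 0) (by simp) n).2.2
  simp only [zero_mul, add_zero] at this
  exact_mod_cast this

theorem iterate_snd_eq (n : ℕ) :
    ((planarMap α)^[n] (x, 0)).2 = (den α x n : ℝ) / den α x (n + 1) := by
  have h1 := one_le_den hα hx hi n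
  have h1' : (1 : ℝ) ≤ den α x (n + 1) := by exact_mod_cast h1
  have := (iterate_snd_mul hα hx hi (y := 0) (by simp) n).2.1
  simp only [zero_mul, add_zero] at this
  rw [eq_div_iff (by positivity), this]

theorem mul_den_le (n : ℕ) :
    α * den α x (n + 1) ≤ den α x (n + 1) + den α x n * (map α)^[n] x := by
  have h1 : (den α x n : ℝ) ≤ den α x (n + 1) := by
    exact_mod_cast den_mono hα hx hi n.le_succ
  have h0 : (0 : ℝ) ≤ den α x n := by
    exact_mod_cast (den_mono hα hx hi (Nat.zero_le n) : den α x 0 ≤ _)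
  have := (iterate_mem hα hx n).1
  nlinarith [hα.2]

/-- The Möbius formula and determinant `± 1` make the difference equal to `± 1 / (q Q)`, where `Q`
is at least `α` times the next denominator by `mul_den_le`. -/
theorem abs_sub_div_le (n : ℕ) :
    |x - num α x (n + 1) / den α x (n + 1)| ≤ 1 / (den α x (n + 1) * (α * den α x (n + 2))) := by
  have h1 : (1 : ℝ) ≤ den α x (n + 1) := by exact_mod_cast one_le_den hα hx hi n
  have h2 : (1 : ℝ) ≤ den α x (n + 2) := by exact_mod_cast one_le_den hα hx hi (n + 1)
  have hQ := mul_den_le hα hx hi (n + 1)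
  have hm := mul_den_add (α := α) hi (n + 1)
  have hdet := abs_det_eq_one α x (n + 1)
  set Q := (den α x (n + 2) : ℝ) + den α x (n + 1) * (map α)^[n + 1] x with hQdef
  have hpos : 0 < α * den α x (n + 2) := mul_pos hα.1 (by linarith)
  have hQ' : α * den α x (n + 2) ≤ Q := hQ
  have hQ0 : 0 < Q := hpos.trans_le hQ'
  have heq : x - num α x (n + 1) / den α x (n + 1)
      = -((num α x (n + 1) * den α x (n + 2) - num α x (n + 2) * den α x (n + 1) : ℤ) : ℝ)
        / (den α x (n + 1) * Q) := by
    have hm' : x * Q = num α x (n + 2) + num α x (n + 1) * (map α)^[n + 1] x := hm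
    field_simp
    push_cast
    linear_combination (den α x (n + 1) : ℝ) * hm' - (num α x (n + 1) : ℝ) * hQdef
  rw [heq, abs_div, abs_neg, ← Int.cast_abs, hdet, abs_of_pos (by positivity)]
  push_cast
  gcongr

/-- While the denominators stagnate, the digit must be 2 and the sign negative. Then `T z - z = (1 +
z)^2 / |z| ≥ α^2`, so the orbit drifts to the right at a definite speed. -/
theorem le_iterate_of_den_le (m k : ℕ) (h : den α x (m + k + 2) ≤ den α x (m + 1)) :
    α - 1 + k * α ^ 2 ≤ (map α)^[m + k + 1] x := by
  induction k with
  | zero => simpa using (iterate_mem hα hx (m + 1)).1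
  | succ k ih =>
    have hmono := den_mono hα hx hi
    have e0 : den α x (m + 1) ≤ den α x (m + k + 1) := hmono (by omega)
    have e1 : den α x (m + k + 1) ≤ den α x (m + k + 2) := hmono (by omega)
    have e2 : den α x (m + k + 2) ≤ den α x (m + k + 3) := hmono (by omega)
    have h' : den α x (m + k + 3) ≤ den α x (m + 1) := h
    have ih := ih (e2.trans h')
    have hs : (map α)^[m + (k + 1) + 1] x = map α ((map α)^[m + k + 1] x) :=
      Function.iterate_succ_apply' ..
    rw [hs]
    set z := (map α)^[m + k + 1] x with hz
    have hz0 : z ≠ 0 := (irrational_iterate hi _).ne_zero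
    have hzI : z ∈ interval α := iterate_mem hα hx _
    have hd := one_le_digit hα hzI hz0
    have hrec : den α x (m + k + 3) = digit α z * den α x (m + k + 2)
      + intSgn z * den α x (m + k + 1) := den_add_two α x (m + k + 1)
    have hpos := one_le_den hα hx hi (m + k)
    have q1 : den α x (m + k + 2) = den α x (m + k + 1) := by omega
    have q2 : den α x (m + k + 3) = den α x (m + k + 1) := by omega
    rw [q1, q2] at hrec
    have hone : digit α z + intSgn z = 1 := by
      have : (digit α z + intSgn z - 1) * den α x (m + k + 1) = 0 := by linarith
      rcases mul_eq_zero.mp this with h | h <;> omega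
    have hneg : z < 0 := by
      by_contra hge
      have : intSgn z = 1 := if_pos (not_lt.mp hge)
      omega
    have hd2 : digit α z = 2 := by
      have : intSgn z = -1 := if_neg (not_le.mpr hneg)
      omega
    have hmap := digit_add_map (α := α) hz0
    rw [hd2, abs_div, abs_one, abs_of_neg hneg] at hmap
    have hge : z + α ^ 2 ≤ 1 / -z - 2 := by
      rw [le_sub_iff_add_le, le_div_iff₀ (by linarith)]
      have h1 := hzI.1
      have h0 := hα.1
      nlinarith [mul_self_nonneg (1 + z - α), hα.2, sq_nonneg α]
    push_cast at hmap ⊢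
    linarith

end Irrational

/-- The drift during stagnation cannot exceed the length 1 of the interval, so the denominators grow
by at least 1 within a number of steps that depends only on `α`. -/
theorem exists_le_den {α : ℝ} (hα : α ∈ Ioc (0 : ℝ) 1) (K : ℕ) :
    ∃ n₀ : ℕ, ∀ n ≥ n₀, ∀ x ∈ interval α, Irrational x → (K : ℤ) ≤ den α x (n + 1) := by
  obtain ⟨k, hk⟩ : ∃ k : ℕ, 1 < k * α ^ 2 := by
    obtain ⟨k, hk⟩ := exists_nat_gt (1 / α ^ 2)
    exact ⟨k, by rwa [div_lt_iff₀ (pow_pos hα.1 2)] at hk⟩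
  suffices h : ∃ n₀ : ℕ, ∀ x ∈ interval α, Irrational x → (K : ℤ) ≤ den α x (n₀ + 1) by
    obtain ⟨n₀, h⟩ := h
    exact ⟨n₀, fun n hn x hx hi => (h x hx hi).trans (den_mono hα hx hi (by omega))⟩
  induction K with
  | zero => exact ⟨0, by simp⟩
  | succ K ih =>
    obtain ⟨m, hm⟩ := ih
    refine ⟨m + k + 1, fun x hx hi => ?_⟩
    by_contra hlt
    have h1 := hm x hx hi
    push_cast at hlt
    have := le_iterate_of_den_le hα hx hi m k (by
      have : m + k + 1 + 1 = m + k + 2 := rfl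
      rw [this] at hlt
      omega)
    have h2 := (iterate_mem hα hx (m + k + 1)).2
    linarith

/-- The second coordinate of `𝒯_α^n (x, y)` forgets `y`, uniformly in `x`. -/
theorem exists_abs_iterate_snd_sub_le {α : ℝ} (hα : α ∈ Ioc (0 : ℝ) 1) {δ : ℝ} (hδ : 0 < δ) :
    ∃ n₀ : ℕ, ∀ n ≥ n₀, ∀ x ∈ interval α, Irrational x → ∀ y ∈ Icc (0 : ℝ) 1,
      |((planarMap α)^[n] (x, y)).2 - ((planarMap α)^[n] (x, 0)).2| ≤ δ := by
  obtain ⟨K, hK⟩ := exists_nat_gt (1 / δ)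
  obtain ⟨n₀, h⟩ := exists_le_den hα K
  refine ⟨n₀, fun n hn x hx hi y hy => ?_⟩
  have hq : (K : ℝ) ≤ den α x (n + 1) := by exact_mod_cast h n hn x hx hi
  have hq1 : (1 : ℝ) ≤ den α x (n + 1) := by exact_mod_cast one_le_den hα hx hi n
  obtain ⟨h1, h2, -⟩ := iterate_snd_mul hα hx hi hy n
  have h3 := iterate_snd_eq hα hx hi n
  set w := (den α x (n + 1) : ℝ) + y * num α x (n + 1) with hw
  -- Both heights come from one Möbius map of determinant `± 1`. Since `w ≥ 1`, the difference is at
  -- most the reciprocal of the denominator.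
  have heq : ((planarMap α)^[n] (x, y)).2 - ((planarMap α)^[n] (x, 0)).2
      = y * ((num α x n * den α x (n + 1) - num α x (n + 1) * den α x n : ℤ) : ℝ)
        / (w * den α x (n + 1)) := by
    rw [h3, ← eq_div_iff (by positivity)] at *
    rw [h2]
    field_simp
    push_cast
    rw [hw]
    ring
  rw [heq, abs_div, abs_mul, ← Int.cast_abs, abs_det_eq_one, abs_of_nonneg hy.1,
    abs_of_pos (by positivity), div_le_iff₀ (by positivity)]
  have : 1 ≤ δ * den α x (n + 1) := by
    rw [div_lt_iff₀ hδ] at hK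
    nlinarith
  push_cast
  nlinarith [hy.2]

/-! ## The domain has positive Lebesgue measure -/

/-- The horizontal section of `Ω_α` at height `r`. -/
def slice (α r : ℝ) : Set ℝ := {t | (t, r) ∈ domain α}

theorem isClosed_domain (α : ℝ) : IsClosed (domain α) := isClosed_closure

theorem isClosed_slice (α r : ℝ) : IsClosed (slice α r) :=
  (isClosed_domain α).preimage (by fun_prop)

theorem iterate_mem_domain {α x : ℝ} (hx : x ∈ Ico (α - 1) α) (n : ℕ) :
    (planarMap α)^[n] (x, 0) ∈ domain α :=
  subset_closure ⟨x, hx, n, rfl⟩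

theorem volume_image_le_of_dist_le {f : ℝ → ℝ} {s : Set ℝ} {c : ℝ} (hc : 0 ≤ c)
    (h : ∀ x ∈ s, ∀ y ∈ s, dist (f x) (f y) ≤ c * dist x y) :
    volume (f '' s) ≤ ENNReal.ofReal c * volume s := by
  have hL : LipschitzOnWith c.toNNReal f s :=
    LipschitzOnWith.of_dist_le_mul fun x hx y hy => by
      rw [Real.coe_toNNReal c hc]; exact h x hx y hy
  have := hL.hausdorffMeasure_image_le (d := 1) zero_le_one
  rw [hausdorffMeasure_real, ENNReal.rpow_one] at this
  exact this

/-- Points whose denominators jump over `[N, 20 N / α]`. -/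
theorem volume_jump_le {α : ℝ} (hα : α ∈ Ioc (0 : ℝ) 1) {N : ℕ} (hN : 1 ≤ N) :
    volume {x : ℝ | x ∈ interval α ∧ Irrational x ∧ ∃ n, den α x (n + 1) < N ∧
      20 * N / α < den α x (n + 2)} ≤ ENNReal.ofReal (1 / 2) := by
  have hN' : (1 : ℝ) ≤ N := by exact_mod_cast hN
  -- A jump puts `x` within `1 / (20 q N)` of a fraction with denominator `q < N`. At most `5 q`
  -- numerators occur, so each `q` contributes at most `1 / (2 N)` and all of them at most `1/2`:
  -- this fixes the constant 20.
  have hsub : {x : ℝ | x ∈ interval α ∧ Irrational x ∧ ∃ n, den α x (n + 1) < N ∧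
      20 * N / α < den α x (n + 2)} ⊆
      ⋃ q ∈ Finset.Ico 1 N, ⋃ p ∈ Finset.Icc (-(2 * q : ℤ)) (2 * q),
        Metric.closedBall ((p : ℝ) / q) (1 / (20 * q * N)) := by
    rintro x ⟨hx, hi, n, h1, h2⟩
    have hq1 := one_le_den hα hx hi n
    have habs := abs_sub_div_le hα hx hi n
    obtain ⟨q, hq⟩ := Int.eq_ofNat_of_zero_le (zero_le_one.trans hq1)
    set p := num α x (n + 1)
    rw [hq] at hq1 h1 habs
    have hqN : q < N := by exact_mod_cast h1
    have hq1 : 1 ≤ q := by exact_mod_cast hq1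
    have hq1' : (1 : ℝ) ≤ q := by exact_mod_cast hq1
    have h2' : 20 * (N : ℝ) < α * den α x (n + 2) := by
      rw [div_lt_iff₀ hα.1] at h2
      linarith
    have hle : |x - p / q| ≤ 1 / (20 * q * N) := by
      refine habs.trans ?_
      push_cast
      rw [show (20 * q * N : ℝ) = q * (20 * N) by ring]
      gcongr
    have hxabs : |x| ≤ 1 := by
      rw [abs_le]; constructor <;> linarith [hx.1, hx.2, hα.1, hα.2]
    have hle1 : |x - p / q| ≤ 1 := by
      refine hle.trans ?_
      rw [div_le_one (by positivity)]
      nlinarith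
    have hp : |(p : ℝ)| ≤ 2 * q := by
      have : |(p : ℝ) / q| ≤ 2 := by
        have := abs_sub_abs_le_abs_sub ((p : ℝ) / q) x
        rw [abs_sub_comm] at this
        linarith
      rw [abs_div, abs_of_pos (by positivity : (0 : ℝ) < q), div_le_iff₀ (by positivity)] at this
      exact this
    have hp' : |p| ≤ 2 * q := by exact_mod_cast hp
    rw [abs_le] at hp'
    simp only [mem_iUnion, Finset.mem_Ico, Finset.mem_Icc]
    exact ⟨q, ⟨hq1, hqN⟩, p, hp', by rwa [Metric.mem_closedBall, Real.dist_eq]⟩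
  refine (measure_mono hsub).trans ?_
  refine (measure_biUnion_finset_le _ _).trans ?_
  have hterm : ∀ q ∈ Finset.Ico 1 N, volume (⋃ p ∈ Finset.Icc (-(2 * q : ℤ)) (2 * q),
        Metric.closedBall ((p : ℝ) / q) (1 / (20 * q * N))) ≤ ENNReal.ofReal (1 / (2 * N)) := by
    intro q hq
    have hq1 : (1 : ℝ) ≤ q := by exact_mod_cast (Finset.mem_Ico.mp hq).1
    refine (measure_biUnion_finset_le _ _).trans ?_
    simp only [Real.volume_closedBall, Finset.sum_const, Int.card_Icc, nsmul_eq_mul]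
    rw [← ENNReal.ofReal_natCast, ← ENNReal.ofReal_mul (by positivity)]
    apply ENNReal.ofReal_le_ofReal
    have hcard : (((2 * (q : ℤ) + 1 - -(2 * q)).toNat : ℕ) : ℝ) ≤ 5 * q := by
      have h1 : (2 * (q : ℤ) + 1 - -(2 * q)).toNat ≤ 5 * q := by
        have := (Finset.mem_Ico.mp hq).1
        omega
      exact_mod_cast h1
    calc _ ≤ (5 * q : ℝ) * (2 * (1 / (20 * q * N))) := by gcongr
      _ = 1 / (2 * N) := by field_simp; norm_num
  refine (Finset.sum_le_sum hterm).trans ?_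
  simp only [Finset.sum_const, Nat.card_Ico, nsmul_eq_mul]
  rw [← ENNReal.ofReal_natCast, ← ENNReal.ofReal_mul (by positivity)]
  apply ENNReal.ofReal_le_ofReal
  rw [mul_one_div, div_le_div_iff₀ (by positivity) (by positivity)]
  have : ((N - 1 : ℕ) : ℝ) ≤ N := by exact_mod_cast Nat.sub_le N 1
  linarith

/-- Look at the first denominator that reaches `N`: if it is too large, its predecessor, still below
`N`, witnesses a jump. -/
theorem exists_den_mem_or {α : ℝ} (hα : α ∈ Ioc (0 : ℝ) 1) {N : ℕ} {x : ℝ}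
    (hx : x ∈ interval α) (hi : Irrational x) (hN : 1 ≤ N) :
    (∃ n, (N : ℤ) ≤ den α x (n + 1) ∧ (den α x (n + 1) : ℝ) ≤ 20 * N / α) ∨
      ∃ n, den α x (n + 1) < N ∧ 20 * N / α < den α x (n + 2) := by
  classical
  have hex : ∃ n, (N : ℤ) ≤ den α x (n + 1) := by
    obtain ⟨n₀, h⟩ := exists_le_den hα N
    exact ⟨n₀, h n₀ le_rfl x hx hi⟩
  by_cases hle : (den α x (Nat.find hex + 1) : ℝ) ≤ 20 * N / α
  · exact Or.inl ⟨_, Nat.find_spec hex, hle⟩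
  · right
    rcases hn : Nat.find hex with _ | m
    · exfalso
      apply hle
      have : (1 : ℝ) ≤ N := by exact_mod_cast hN
      rw [hn, zero_add, den_one, le_div_iff₀ hα.1]
      push_cast
      nlinarith [hα.2]
    · rw [hn] at hle
      exact ⟨m, not_le.mp (Nat.find_min hex (by omega)), not_le.mp hle⟩

/-- The points that have `q' / q` among their quotients of consecutive denominators. -/
def denSet (α : ℝ) (q' q : ℤ) : Set ℝ :=
  {x | x ∈ Ico (α - 1) α ∧ Irrational x ∧ ∃ n, den α x n = q' ∧ den α x (n + 1) = q}

/-- Such an `x` is a Möbius image of `T^n x`, which lies in the slice. The denominators of the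
Möbius map are prescribed; the numerators are then determined up to a sign and an integer
translation. Boundedness leaves `2 * 7 = 14` maps, each contracting by `1 / (α q)^2`. -/
theorem volume_denSet_le {α : ℝ} (hα : α ∈ Ioc (0 : ℝ) 1) {q' q : ℤ} (hq : 1 ≤ α * q) :
    volume (denSet α q' q) ≤
      ENNReal.ofReal (14 / (α * q) ^ 2) * volume (slice α (q' / q)) := by
  rcases (denSet α q' q).eq_empty_or_nonempty with he | ⟨x₀, hx₀, hi₀, n₀, h₀', h₀⟩
  · simp [he]
  have hx₀' := Ico_subset_Icc_self hx₀
  have hq0 : (0 : ℝ) < q := by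
    have := hα.1
    by_contra h
    nlinarith
  have hαq : 0 < α * q := by linarith
  -- membership in the slice and the denominator bound
  have hslice : ∀ x ∈ Ico (α - 1) α, Irrational x → ∀ n, den α x n = q' → den α x (n + 1) = q →
      (map α)^[n] x ∈ slice α (q' / q) := by
    intro x hx hi n h' h
    have h1 := iterate_mem_domain hx n
    have h2 := iterate_snd_eq hα (Ico_subset_Icc_self hx) hi n
    have h3 := planarMap_iterate_fst α n (x, 0)
    rw [← Prod.mk.eta (p := (planarMap α)^[n] (x, 0)), h2, h3, h, h'] at h1
    exact h1
  have hq'0 : (0 : ℝ) ≤ q' := by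
    rw [← h₀']; exact_mod_cast den_mono hα hx₀' hi₀ (Nat.zero_le n₀)
  have hq'q : (q' : ℝ) ≤ q := by
    rw [← h₀, ← h₀']; exact_mod_cast den_mono hα hx₀' hi₀ n₀.le_succ
  have hmemI : ∀ t ∈ slice α (q' / q), t ∈ interval α := fun t ht => (domain_subset hα ht).1
  have hden : ∀ t ∈ interval α, α * q ≤ q + q' * t := by
    intro t ht
    nlinarith [ht.1, hα.2]
  set p' := num α x₀ n₀ with hp'
  set p := num α x₀ (n₀ + 1) with hp
  have hdet : |p' * q - p * q'| = 1 := by rw [← h₀, ← h₀']; exact abs_det_eq_one α x₀ n₀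
  set f : ℝ → ℝ := fun t => (p + p' * t) / (q + q' * t) with hf
  have hdist : ∀ s ∈ interval α, ∀ t ∈ interval α,
      dist (f s) (f t) ≤ 1 / (α * q) ^ 2 * dist s t := by
    intro s hs t ht
    have h1 := hden s hs
    have h2 := hden t ht
    have h1' : 0 < q + q' * s := by linarith
    have h2' : 0 < q + q' * t := by linarith
    have : f s - f t = ((p' * q - p * q' : ℤ) : ℝ) * (s - t) / ((q + q' * s) * (q + q' * t)) := by
      simp only [hf]
      rw [div_sub_div _ _ h1'.ne' h2'.ne']
      congr 1
      push_cast
      ring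
    rw [Real.dist_eq, Real.dist_eq, this, abs_div, abs_mul, ← Int.cast_abs, hdet,
      abs_of_pos (mul_pos h1' h2'), div_mul_eq_mul_div, pow_two]
    push_cast
    gcongr
  have hfx : ∀ x ∈ Ico (α - 1) α, Irrational x → ∀ n, den α x n = q' → den α x (n + 1) = q →
      x = (num α x (n + 1) + num α x n * (map α)^[n] x) / (q + q' * (map α)^[n] x) := by
    intro x hx hi n h' h
    have h1 := mul_den_add (α := α) hi n
    have h2 := hden _ (iterate_mem hα (Ico_subset_Icc_self hx) n)
    rw [h, h'] at h1
    rw [eq_div_iff (by linarith), h1]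
  -- Coprimality makes two numerator pairs with equal determinant differ by an integer multiple of
  -- the denominator pair.
  have hcop : IsCoprime q q' := by
    rcases (abs_eq zero_le_one).mp hdet with h | h
    · exact ⟨p', -p, by linarith⟩
    · exact ⟨-p', p, by linarith⟩
  have hsub : denSet α q' q ⊆ ⋃ σ ∈ ({1, -1} : Finset ℤ), ⋃ k ∈ Finset.Icc (-3 : ℤ) 3,
      (fun t => σ * f t + k) '' slice α (q' / q) := by
    rintro x ⟨hx, hi, n, h', h⟩
    have hdet2 := abs_det_eq_one α x n
    have hxf := hfx x hx hi n h' h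
    have hts := hslice x hx hi n h' h
    rw [h, h'] at hdet2
    obtain ⟨σ, hσ, hσdet⟩ : ∃ σ ∈ ({1, -1} : Finset ℤ),
        num α x n * q - num α x (n + 1) * q' = σ * (p' * q - p * q') := by
      rcases (abs_eq zero_le_one).mp hdet with e | e <;>
      rcases (abs_eq zero_le_one).mp hdet2 with e' | e' <;> rw [e, e']
      · exact ⟨1, by simp, by simp⟩
      · exact ⟨-1, by simp, by simp⟩
      · exact ⟨-1, by simp, by simp⟩
      · exact ⟨1, by simp, by simp⟩
    obtain ⟨k, hk⟩ : q ∣ num α x (n + 1) - σ * p := by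
      refine hcop.dvd_of_dvd_mul_right ⟨num α x n - σ * p', ?_⟩
      linear_combination -hσdet
    have hqz : q ≠ 0 := by rintro rfl; simp at hq0
    have hk' : num α x n - σ * p' = k * q' := by
      apply mul_right_cancel₀ hqz
      linear_combination hσdet + q' * hk
    set t := (map α)^[n] x with ht
    have htI := hmemI t hts
    have hxe : x = σ * f t + k := by
      have h1 := hden t htI
      have h1' : (q : ℝ) + q' * t ≠ 0 := by linarith
      have e1 : (num α x (n + 1) : ℝ) = σ * p + q * k := by
        have : num α x (n + 1) = σ * p + q * k := by linarith
        exact_mod_cast this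
      have e2 : (num α x n : ℝ) = σ * p' + k * q' := by
        have : num α x n = σ * p' + k * q' := by linarith
        exact_mod_cast this
      rw [hxf, e1, e2]
      simp only [hf]
      field_simp
      ring
    -- Here `k = x - σ f(t)` with `|x| ≤ 1`, and `|f(t)| ≤ 2` because `f` contracts and takes the
    -- value `x₀` on the interval.
    have hkb : |k| ≤ 3 := by
      have hI : ∀ z ∈ interval α, |z| ≤ 1 := fun z hz => by
        rw [abs_le]; constructor <;> linarith [hz.1, hz.2, hα.1, hα.2]
      have hx1 := hI x (Ico_subset_Icc_self hx)
      have hx2 := hI x₀ hx₀'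
      set t₀ := (map α)^[n₀] x₀ with ht₀
      have ht₀I : t₀ ∈ interval α := iterate_mem hα hx₀' n₀
      have hf0 : f t₀ = x₀ := (hfx x₀ hx₀ hi₀ n₀ h₀' h₀).symm
      have hd := hdist t htI t₀ ht₀I
      rw [hf0, Real.dist_eq, Real.dist_eq] at hd
      have hd1 : |t - t₀| ≤ 1 := by
        rw [abs_le]; constructor <;> linarith [htI.1, htI.2, ht₀I.1, ht₀I.2]
      have hd2 : 1 / (α * q) ^ 2 ≤ 1 := by
        rw [div_le_one (by positivity)]; nlinarith
      have hd3 : |f t - x₀| ≤ 1 := hd.trans (by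
        calc _ ≤ 1 * |t - t₀| := by gcongr
          _ ≤ 1 := by linarith)
      have hft : |f t| ≤ 2 := by
        have := abs_sub_abs_le_abs_sub (f t) x₀
        linarith
      have hσf : |(σ : ℝ) * f t| = |f t| := by
        simp only [Finset.mem_insert, Finset.mem_singleton] at hσ
        rcases hσ with rfl | rfl <;> simp
      have : |(k : ℝ)| ≤ 3 := by
        have e : (k : ℝ) = x - σ * f t := by linarith
        rw [e]
        have := abs_sub x (σ * f t)
        linarith
      exact_mod_cast this
    simp only [mem_iUnion, Finset.mem_Icc]
    exact ⟨σ, hσ, k, abs_le.mp hkb, t, hts, hxe.symm⟩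
  have himg : ∀ σ ∈ ({1, -1} : Finset ℤ), ∀ k : ℤ,
      volume ((fun t => σ * f t + k) '' slice α (q' / q)) ≤
        ENNReal.ofReal (1 / (α * q) ^ 2) * volume (slice α (q' / q)) := by
    intro σ hσ k
    refine volume_image_le_of_dist_le (by positivity) fun s hs t ht => ?_
    refine le_trans (le_of_eq ?_) (hdist s (hmemI s hs) t (hmemI t ht))
    simp only [Finset.mem_insert, Finset.mem_singleton] at hσ
    rw [Real.dist_eq, Real.dist_eq]
    rcases hσ with rfl | rfl
    · congr 1; push_cast; ring
    · rw [abs_sub_comm (f s)]; congr 1; push_cast; ring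
  calc volume (denSet α q' q)
      ≤ _ := measure_mono hsub
    _ ≤ ∑ σ ∈ ({1, -1} : Finset ℤ), ∑ k ∈ Finset.Icc (-3 : ℤ) 3,
        volume ((fun t => σ * f t + k) '' slice α (q' / q)) :=
      (measure_biUnion_finset_le _ _).trans
        (Finset.sum_le_sum fun σ _ => measure_biUnion_finset_le _ _)
    _ ≤ ∑ σ ∈ ({1, -1} : Finset ℤ), ∑ k ∈ Finset.Icc (-3 : ℤ) 3,
        ENNReal.ofReal (1 / (α * q) ^ 2) * volume (slice α (q' / q)) :=
      Finset.sum_le_sum fun σ hσ => Finset.sum_le_sum fun k _ => himg σ hσ k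
    _ = ENNReal.ofReal (14 / (α * q) ^ 2) * volume (slice α (q' / q)) := by
      have hc : ({1, -1} : Finset ℤ).card = 2 := rfl
      simp only [Finset.sum_const, hc, Int.card_Icc, nsmul_eq_mul]
      rw [← mul_assoc, ← mul_assoc, show (14 : ℝ) / (α * q) ^ 2 = 14 * (1 / (α * q) ^ 2) by ring,
        ENNReal.ofReal_mul (by norm_num)]
      congr 2
      rw [show (3 + 1 - -3 : ℤ).toNat = 7 from rfl]
      norm_num

/-- Pairs of coprime integers `0 ≤ q'`, `N ≤ q` up to `20 N / α`. -/
noncomputable def fractions (α : ℝ) (N : ℕ) : Finset (ℤ × ℤ) :=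
  (Finset.Icc 0 ⌊20 * N / α⌋ ×ˢ Finset.Icc (N : ℤ) ⌊20 * N / α⌋).filter
    fun a => IsCoprime a.1 a.2

theorem half_le_sum_denSet {α : ℝ} (hα : α ∈ Ioc (0 : ℝ) 1) {N : ℕ} (hN : 1 ≤ N) :
    ENNReal.ofReal (1 / 2) ≤ ∑ a ∈ fractions α N, volume (denSet α a.1 a.2) := by
  have hcover : Ico (α - 1) α ⊆ range ((↑) : ℚ → ℝ) ∪ ({x : ℝ | x ∈ interval α ∧ Irrational x ∧
      ∃ n, den α x (n + 1) < N ∧ 20 * N / α < den α x (n + 2)} ∪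
      ⋃ a ∈ fractions α N, denSet α a.1 a.2) := by
    intro x hx
    by_cases hi : Irrational x
    · right
      have hxI := Ico_subset_Icc_self hx
      rcases exists_den_mem_or hα hxI hi hN with ⟨n, h1, h2⟩ | h
      · right
        have h0 : 0 ≤ den α x n := den_mono hα hxI hi (Nat.zero_le n)
        have hle : den α x n ≤ den α x (n + 1) := den_mono hα hxI hi n.le_succ
        have h2' : den α x (n + 1) ≤ ⌊20 * N / α⌋ := Int.le_floor.mpr h2
        have hcop : IsCoprime (den α x n) (den α x (n + 1)) := by
          rcases (abs_eq zero_le_one).mp (abs_det_eq_one α x n) with h | h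
          · exact ⟨-num α x (n + 1), num α x n, by linarith⟩
          · exact ⟨num α x (n + 1), -num α x n, by linarith⟩
        simp only [mem_iUnion]
        refine ⟨(den α x n, den α x (n + 1)), ?_, hx, hi, n, rfl, rfl⟩
        simp only [fractions, Finset.mem_filter, Finset.mem_product, Finset.mem_Icc]
        exact ⟨⟨⟨h0, hle.trans h2'⟩, h1, h2'⟩, hcop⟩
      · exact Or.inl ⟨hxI, hi, h⟩
    · left
      unfold Irrational at hi
      exact not_not.mp hi
  have h1 : (1 : ENNReal) ≤ ENNReal.ofReal (1 / 2) +
      ∑ a ∈ fractions α N, volume (denSet α a.1 a.2) := by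
    calc (1 : ENNReal) = volume (Ico (α - 1) α) := by rw [Real.volume_Ico]; simp
      _ ≤ _ := measure_mono hcover
      _ ≤ volume (range ((↑) : ℚ → ℝ)) + _ := measure_union_le _ _
      _ ≤ 0 + _ := by rw [(countable_range _).measure_zero]
      _ ≤ _ := by
        rw [zero_add]
        exact (measure_union_le _ _).trans
          (add_le_add (volume_jump_le hα hN) (measure_biUnion_finset_le _ _))
  have h2 : (1 : ENNReal) = ENNReal.ofReal (1 / 2) + ENNReal.ofReal (1 / 2) := by
    rw [← ENNReal.ofReal_add (by norm_num) (by norm_num)]; norm_num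
  rw [h2] at h1
  exact (ENNReal.add_le_add_iff_left ENNReal.ofReal_ne_top).mp h1

/-- Distinct reduced fractions with denominators at most `20 N / α` differ by at least `(α / (20
N))^2`, so vertical thickenings of the slices by half of this are disjoint. -/
theorem sum_slice_le {α : ℝ} (hα : α ∈ Ioc (0 : ℝ) 1) {N : ℕ} (hN : 1 ≤ N) :
    ENNReal.ofReal ((α / (20 * N)) ^ 2) * ∑ a ∈ fractions α N, volume (slice α (a.1 / a.2)) ≤
      volume (Metric.thickening ((α / (20 * N)) ^ 2 / 2) (domain α)) := by
  have hN' : (1 : ℝ) ≤ N := by exact_mod_cast hN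
  have hα0 := hα.1
  set δ := (α / (20 * N)) ^ 2 / 2 with hδ
  have hδ0 : 0 < δ := by positivity
  have hmem : ∀ a ∈ fractions α N, 0 ≤ a.1 ∧ 1 ≤ a.2 ∧ (a.2 : ℝ) ≤ 20 * N / α ∧
      IsCoprime a.1 a.2 := by
    intro a ha
    simp only [fractions, Finset.mem_filter, Finset.mem_product, Finset.mem_Icc] at ha
    obtain ⟨⟨⟨h1, -⟩, h2, h3⟩, h4⟩ := ha
    exact ⟨h1, by omega, Int.le_floor.mp h3, h4⟩
  have hsub : ⋃ a ∈ fractions α N,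
      slice α (a.1 / a.2) ×ˢ Metric.ball ((a.1 : ℝ) / a.2) δ ⊆
      Metric.thickening δ (domain α) := by
    intro z hz
    simp only [mem_iUnion] at hz
    obtain ⟨a, -, h1, h2⟩ := hz
    rw [Metric.mem_thickening_iff]
    refine ⟨(z.1, a.1 / a.2), h1, ?_⟩
    rw [Prod.dist_eq]
    simpa [hδ0] using h2
  have hdisj : (fractions α N : Set (ℤ × ℤ)).PairwiseDisjoint
      (fun a => slice α (a.1 / a.2) ×ˢ Metric.ball ((a.1 : ℝ) / a.2) δ) := by
    intro a ha b hb hab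
    obtain ⟨a1, a2, a3, a4⟩ := hmem a ha
    obtain ⟨b1, b2, b3, b4⟩ := hmem b hb
    refine Set.Disjoint.set_prod_right (Metric.ball_disjoint_ball ?_) _ _
    have ha0 : (0 : ℝ) < a.2 := by exact_mod_cast a2
    have hb0 : (0 : ℝ) < b.2 := by exact_mod_cast b2
    have hne : a.1 * b.2 - a.2 * b.1 ≠ 0 := by
      intro h0
      apply hab
      have e : a.1 * b.2 = a.2 * b.1 := by linarith
      have h1 : a.2 ∣ b.2 := a4.symm.dvd_of_dvd_mul_left ⟨b.1, e⟩
      have h2 : b.2 ∣ a.2 := b4.symm.dvd_of_dvd_mul_right ⟨a.1, by linarith⟩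
      have h3 : a.2 = b.2 := Int.dvd_antisymm (by omega) (by omega) h1 h2
      have h4 : a.1 = b.1 := by
        rw [h3, mul_comm b.2] at e
        exact mul_right_cancel₀ (by omega) e
      exact Prod.ext h4 h3
    have hge : (1 : ℝ) ≤ |((a.1 * b.2 - a.2 * b.1 : ℤ) : ℝ)| := by
      rw [← Int.cast_abs]
      exact_mod_cast Int.one_le_abs hne
    rw [Real.dist_eq, div_sub_div _ _ ha0.ne' hb0.ne', abs_div, abs_of_pos (mul_pos ha0 hb0)]
    have hab2 : (a.2 : ℝ) * b.2 ≤ (20 * N / α) * (20 * N / α) := by gcongr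
    have hδδ : δ + δ = 1 / ((20 * N / α) * (20 * N / α)) := by
      rw [hδ]; field_simp; norm_num
    rw [hδδ]
    push_cast at hge
    gcongr
  calc _ = ∑ a ∈ fractions α N,
        volume (slice α (a.1 / a.2) ×ˢ Metric.ball ((a.1 : ℝ) / a.2) δ) := by
        rw [Finset.mul_sum]
        refine Finset.sum_congr rfl fun a _ => ?_
        rw [Measure.volume_eq_prod, Measure.prod_prod, Real.volume_ball, mul_comm]
        congr 2
        rw [hδ]; ring
    _ = volume (⋃ a ∈ fractions α N,
        slice α (a.1 / a.2) ×ˢ Metric.ball ((a.1 : ℝ) / a.2) δ) := by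
        rw [measure_biUnion_finset hdisj fun a _ =>
          (isClosed_slice α _).measurableSet.prod measurableSet_ball]
    _ ≤ _ := measure_mono hsub

theorem isCompact_domain {α : ℝ} (hα : α ∈ Ioc (0 : ℝ) 1) : IsCompact (domain α) :=
  (isCompact_Icc.prod isCompact_Icc).of_isClosed_subset (isClosed_domain α) (domain_subset hα)

/-- The slices have total length at least `(α N)^2 / 28`, and the separation is `α^2 / (400 N^2)`.
In the product `N` cancels, with `28 * 400 = 11200`. -/
theorem le_volume_thickening {α : ℝ} (hα : α ∈ Ioc (0 : ℝ) 1) {N : ℕ} (hN : 1 ≤ α * N) :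
    ENNReal.ofReal (α ^ 4 / 11200) ≤
      volume (Metric.thickening ((α / (20 * N)) ^ 2 / 2) (domain α)) := by
  have hα0 := hα.1
  have hN0 : (0 : ℝ) < N := by
    by_contra h
    nlinarith
  have hN1 : 1 ≤ N := by exact_mod_cast hN0
  have h1 := half_le_sum_denSet hα hN1
  have h2 := sum_slice_le hα hN1
  refine le_trans ?_ h2
  have h3 : ∑ a ∈ fractions α N, volume (denSet α a.1 a.2) ≤
      ENNReal.ofReal (14 / (α * N) ^ 2) *
        ∑ a ∈ fractions α N, volume (slice α (a.1 / a.2)) := by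
    rw [Finset.mul_sum]
    refine Finset.sum_le_sum fun a ha => ?_
    simp only [fractions, Finset.mem_filter, Finset.mem_product, Finset.mem_Icc] at ha
    have haN : (N : ℝ) ≤ a.2 := by exact_mod_cast ha.1.2.1
    have hle : α * N ≤ α * a.2 := by gcongr
    refine (volume_denSet_le hα (hN.trans hle)).trans ?_
    gcongr
  have h4 := h1.trans h3
  set s := ∑ a ∈ fractions α N, volume (slice α (a.1 / a.2))
  calc ENNReal.ofReal (α ^ 4 / 11200)
      = ENNReal.ofReal (α ^ 4 * N ^ 2 * α⁻¹ ^ 2 * α ^ 2 / (5600 * N ^ 2)) *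
          ENNReal.ofReal (1 / 2) := by
        rw [← ENNReal.ofReal_mul (by positivity)]
        congr 1
        field_simp
        norm_num
    _ ≤ ENNReal.ofReal (α ^ 4 * N ^ 2 * α⁻¹ ^ 2 * α ^ 2 / (5600 * N ^ 2)) *
          (ENNReal.ofReal (14 / (α * N) ^ 2) * s) := by gcongr
    _ = ENNReal.ofReal ((α / (20 * N)) ^ 2) * s := by
        rw [← mul_assoc, ← ENNReal.ofReal_mul (by positivity)]
        congr 2
        field_simp
        norm_num

theorem volume_domain_pos {α : ℝ} (hα : α ∈ Ioc (0 : ℝ) 1) : 0 < volume (domain α) := by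
  have hα0 := hα.1
  have hfin : ∃ R > 0, volume (Metric.thickening R (domain α)) ≠ ⊤ :=
    ⟨1, one_pos, ((isCompact_domain hα).isBounded.thickening).measure_lt_top.ne⟩
  have ht := tendsto_measure_thickening_of_isClosed hfin (isClosed_domain α)
  have hδ : Filter.Tendsto (fun N : ℕ => (α / (20 * N)) ^ 2 / 2) Filter.atTop
      (nhdsWithin 0 (Ioi 0)) := by
    rw [tendsto_nhdsWithin_iff]
    constructor
    · have h1 : Filter.Tendsto (fun N : ℕ => α / (20 * (N : ℝ))) Filter.atTop (nhds 0) :=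
        Filter.Tendsto.div_atTop tendsto_const_nhds
          (Filter.Tendsto.const_mul_atTop (by norm_num) tendsto_natCast_atTop_atTop)
      simpa using (h1.pow 2).div_const 2
    · filter_upwards [Filter.eventually_gt_atTop 0] with N hN
      have : (0 : ℝ) < N := by exact_mod_cast hN
      exact mem_Ioi.mpr (by positivity)
  have hge : ENNReal.ofReal (α ^ 4 / 11200) ≤ volume (domain α) := by
    refine ge_of_tendsto (ht.comp hδ) ?_
    obtain ⟨N₀, hN₀⟩ := exists_nat_ge (1 / α)
    filter_upwards [Filter.eventually_ge_atTop N₀] with N hN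
    refine le_volume_thickening hα ?_
    have : (N₀ : ℝ) ≤ N := by exact_mod_cast hN
    rw [div_le_iff₀ hα0] at hN₀
    nlinarith
  exact (ENNReal.ofReal_pos.mpr (by positivity)).trans_le hge

/-! ## Null sets and measurability -/

theorem planeMeasure_absolutelyContinuous : planeMeasure ≪ (volume : Measure (ℝ × ℝ)) :=
  withDensity_absolutelyContinuous _ _

theorem ae_fst_notMem {s : Set ℝ} (hs : s.Countable) : ∀ᵐ p ∂planeMeasure, p.1 ∉ s := by
  apply planeMeasure_absolutelyContinuous.ae_le
  rw [Measure.volume_eq_prod]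
  exact Measure.quasiMeasurePreserving_fst.ae (hs.ae_notMem volume)

theorem ae_snd_notMem {s : Set ℝ} (hs : s.Countable) : ∀ᵐ p ∂planeMeasure, p.2 ∉ s := by
  apply planeMeasure_absolutelyContinuous.ae_le
  rw [Measure.volume_eq_prod]
  exact Measure.quasiMeasurePreserving_snd.ae (hs.ae_notMem volume)

theorem ae_irrational_fst : ∀ᵐ p ∂planeMeasure, Irrational p.1 :=
  ae_fst_notMem (countable_range _)

theorem ae_irrational_snd : ∀ᵐ p ∂planeMeasure, Irrational p.2 :=
  ae_snd_notMem (countable_range _)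

theorem measurable_digit (α : ℝ) : Measurable (digit α) := by
  unfold digit
  have : Measurable fun x : ℝ => |1 / x| + 1 - α := by fun_prop
  exact this.floor

theorem measurable_intSgn : Measurable intSgn :=
  Measurable.ite measurableSet_Ici measurable_const measurable_const

theorem measurable_sgn : Measurable sgn :=
  Measurable.ite measurableSet_Ici measurable_const measurable_const

theorem measurable_digit_cast (α : ℝ) : Measurable fun x => (digit α x : ℝ) :=
  measurable_from_top.comp (measurable_digit α)

theorem measurable_map (α : ℝ) : Measurable (map α) := by
  have := measurable_digit_cast α
  refine Measurable.ite (measurableSet_singleton 0) measurable_const ?_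
  fun_prop

theorem measurable_planarMap (α : ℝ) : Measurable (planarMap α) := by
  have h1 := measurable_digit_cast α
  have h2 := measurable_sgn
  have h3 := measurable_map α
  refine Measurable.prodMk (by fun_prop) (Measurable.ite ?_ measurable_const ?_)
  · exact measurable_fst (measurableSet_singleton 0)
  · exact ((h1.comp measurable_fst).add ((h2.comp measurable_fst).mul measurable_snd)).const_div 1

theorem measurable_density : Measurable fun p : ℝ × ℝ =>
    ENNReal.ofReal (1 / (1 + p.1 * p.2) ^ 2) := by fun_prop

theorem measurableSet_domain (α : ℝ) : MeasurableSet (domain α) :=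
  (isClosed_domain α).measurableSet

theorem le_one_add_mul {α : ℝ} (hα : α ∈ Ioc (0 : ℝ) 1) {x y : ℝ} (hx : x ∈ interval α)
    (hy : y ∈ Icc (0 : ℝ) 1) : α ≤ 1 + x * y := by
  nlinarith [hx.1, hy.1, hy.2, hα.2]

theorem planeMeasure_domain_ne_zero {α : ℝ} (hα : α ∈ Ioc (0 : ℝ) 1) :
    planeMeasure (domain α) ≠ 0 := by
  rw [planeMeasure, withDensity_apply _ (measurableSet_domain α)]
  refine ((setLIntegral_pos_iff measurable_density).mpr ?_).ne'
  refine (volume_domain_pos hα).trans_le (measure_mono fun p hp => ⟨?_, hp⟩)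
  have := le_one_add_mul hα (domain_subset hα hp).1 (domain_subset hα hp).2
  have h0 := hα.1
  rw [Function.mem_support]
  have : 0 < 1 + p.1 * p.2 := by linarith
  exact (ENNReal.ofReal_pos.mpr (by positivity)).ne'

theorem planeMeasure_domain_ne_top {α : ℝ} (hα : α ∈ Ioc (0 : ℝ) 1) :
    planeMeasure (domain α) ≠ ⊤ := by
  rw [planeMeasure, withDensity_apply _ (measurableSet_domain α)]
  refine ((setLIntegral_mono measurable_const (g := fun _ => ENNReal.ofReal (1 / α ^ 2))
    fun p hp => ?_).trans_lt ?_).ne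
  · have := le_one_add_mul hα (domain_subset hα hp).1 (domain_subset hα hp).2
    have h0 := hα.1
    apply ENNReal.ofReal_le_ofReal
    gcongr
  · rw [setLIntegral_const]
    exact ENNReal.mul_lt_top ENNReal.ofReal_lt_top (isCompact_domain hα).measure_lt_top

/-! ## `𝒯_α` maps `Ω_α` to itself -/

/-- The points in the orbits of `[α - 1, α) × {0}`. -/
def orbits (α : ℝ) : Set (ℝ × ℝ) :=
  {p | ∃ x ∈ Ico (α - 1) α, ∃ n : ℕ, p = (planarMap α)^[n] (x, 0)}

theorem orbits_subset_domain (α : ℝ) : orbits α ⊆ domain α := subset_closure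

theorem planarMap_mem_orbits {α : ℝ} {p : ℝ × ℝ} (hp : p ∈ orbits α) :
    planarMap α p ∈ orbits α := by
  obtain ⟨x, hx, n, rfl⟩ := hp
  exact ⟨x, hx, n + 1, (Function.iterate_succ_apply' ..).symm⟩

theorem eq_or_exists_of_mem_orbits {α : ℝ} {p : ℝ × ℝ} (hp : p ∈ orbits α) :
    p.2 = 0 ∨ ∃ q ∈ orbits α, q.1 ≠ 0 ∧ p = planarMap α q := by
  obtain ⟨x, hx, n, rfl⟩ := hp
  rcases n with _ | n
  · exact Or.inl rfl
  · rw [Function.iterate_succ_apply']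
    by_cases h0 : ((planarMap α)^[n] (x, 0)).1 = 0
    · left; simp [planarMap, h0]
    · exact Or.inr ⟨_, ⟨x, hx, n, rfl⟩, h0, rfl⟩

/-- The branch of `𝒯_α` with sign `ε` and digit `d`. -/
noncomputable def branch (ε d : ℝ) (p : ℝ × ℝ) : ℝ × ℝ := (ε / p.1 - d, 1 / (d + ε * p.2))

theorem abs_one_div_eq (x : ℝ) : |1 / x| = sgn x / x := by
  rcases eq_or_ne x 0 with rfl | hx
  · simp
  · rw [abs_div, abs_one, div_eq_div_iff (abs_ne_zero.mpr hx) hx, one_mul, sgn_mul_abs]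

theorem planarMap_eq_branch {α : ℝ} {p : ℝ × ℝ} (hp : p.1 ≠ 0) :
    planarMap α p = branch (sgn p.1) (digit α p.1) p := by
  simp only [planarMap, branch, map, hp, abs_one_div_eq, if_false]

/-- The points where the first coordinate of `𝒯_α` jumps. -/
theorem countable_jumps (α : ℝ) : {x : ℝ | ∃ k : ℤ, |1 / x| + 1 - α = k}.Countable := by
  have hsub : {x : ℝ | ∃ k : ℤ, |1 / x| + 1 - α = k} ⊆
      (range fun k : ℤ => 1 / (k + α - 1)) ∪ range fun k : ℤ => -(1 / (k + α - 1)) := by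
    rintro x ⟨k, hk⟩
    have h : |1 / x| = k + α - 1 := by linarith
    rcases abs_choice (1 / x) with e | e
    · exact Or.inl ⟨k, by dsimp only; rw [← h, e, one_div_one_div]⟩
    · exact Or.inr ⟨k, by dsimp only; rw [← h, e, one_div_neg_eq_neg_one_div, one_div_one_div,
        neg_neg]⟩
  exact ((countable_range _).union (countable_range _)).mono hsub

theorem eventually_digit_eq {α x : ℝ} (hx : x ≠ 0) (hj : ∀ k : ℤ, |1 / x| + 1 - α ≠ k) :
    ∀ᶠ z in nhds x, digit α z = digit α x := by
  have hc : ContinuousAt (fun z : ℝ => |1 / z| + 1 - α) x := by fun_prop (disch := exact hx)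
  have hlt : (⌊|1 / x| + 1 - α⌋ : ℝ) < |1 / x| + 1 - α :=
    lt_of_le_of_ne (Int.floor_le _) (hj _).symm
  filter_upwards [hc.eventually (Ioo_mem_nhds hlt (Int.lt_floor_add_one _))] with z hz
  exact Int.floor_eq_iff.mpr ⟨hz.1.le, hz.2⟩

theorem eventually_sgn_eq {x : ℝ} (hx : x ≠ 0) : ∀ᶠ z in nhds x, sgn z = sgn x := by
  rcases lt_or_gt_of_ne hx with h | h
  · filter_upwards [Iio_mem_nhds h] with z hz
    rw [sgn, sgn, if_neg (not_le.mpr h), if_neg (not_le.mpr hz)]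
  · filter_upwards [Ioi_mem_nhds h] with z hz
    rw [sgn, sgn, if_pos h.le, if_pos (le_of_lt hz)]

theorem continuousAt_planarMap {α : ℝ} (hα : α ∈ Ioc (0 : ℝ) 1) {p : ℝ × ℝ}
    (hp : p ∈ interval α ×ˢ Icc (0 : ℝ) 1) (h0 : p.1 ≠ 0)
    (hj : ∀ k : ℤ, |1 / p.1| + 1 - α ≠ k) : ContinuousAt (planarMap α) p := by
  have hd := one_le_denom hα hp.1 h0 hp.2
  have hne : (digit α p.1 : ℝ) + sgn p.1 * p.2 ≠ 0 := by linarith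
  have hb : ContinuousAt (branch (sgn p.1) (digit α p.1)) p := by
    unfold branch
    fun_prop (disch := assumption)
  refine hb.congr ?_
  filter_upwards [continuousAt_fst.eventually (eventually_digit_eq h0 hj),
    continuousAt_fst.eventually (eventually_sgn_eq h0),
    continuousAt_fst.eventually (isOpen_ne.mem_nhds h0)] with q h1 h2 h3
  rw [planarMap_eq_branch h3, h1, h2]

/-- The set of orbits is invariant, and invariance passes to its closure at points of continuity. -/
theorem ae_planarMap_mem_domain {α : ℝ} (hα : α ∈ Ioc (0 : ℝ) 1) :
    ∀ᵐ p ∂planeMeasure, p ∈ domain α → planarMap α p ∈ domain α := by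
  filter_upwards [ae_irrational_fst, ae_fst_notMem (countable_jumps α)] with p hi hj hp
  have hc := continuousAt_planarMap hα (domain_subset hα hp) hi.ne_zero
    (fun k hk => hj ⟨k, hk⟩)
  have := mem_closure_image hc hp
  refine closure_mono ?_ this
  rintro _ ⟨q, hq, rfl⟩
  exact planarMap_mem_orbits hq

/-! ## `𝒯_α` maps `Ω_α` onto itself -/

/-- The inverse of `branch ε d`, for `ε = ± 1`. -/
noncomputable def invBranch (ε d : ℝ) (p : ℝ × ℝ) : ℝ × ℝ := (ε / (p.1 + d), ε * (1 / p.2 - d))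

theorem invBranch_branch {ε d : ℝ} (hε : ε * ε = 1) (p : ℝ × ℝ) :
    invBranch ε d (branch ε d p) = p := by
  have hε0 : ε ≠ 0 := left_ne_zero_of_mul_eq_one hε
  ext
  · simp only [invBranch, branch]; rw [sub_add_cancel, div_div_cancel₀ hε0]
  · simp only [invBranch, branch, one_div_one_div]; linear_combination p.2 * hε

theorem branch_invBranch {ε d : ℝ} (hε : ε * ε = 1) (p : ℝ × ℝ) :
    branch ε d (invBranch ε d p) = p := by
  have hε0 : ε ≠ 0 := left_ne_zero_of_mul_eq_one hε
  ext
  · simp only [invBranch, branch]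
    rw [div_div_cancel₀ hε0]; ring
  · simp only [invBranch, branch]
    rw [← mul_assoc, hε, one_mul, add_sub_cancel, one_div_one_div]

/-- Orbit points near `p` have height above `p.2 / 2 > 0`, so they are images of orbit points under
branches with bounded digit. One of these finitely many branches accumulates at `p`, and its
continuous inverse provides the preimage. -/
theorem exists_planarMap_eq {α : ℝ} (hα : α ∈ Ioc (0 : ℝ) 1) {p : ℝ × ℝ} (hp : p ∈ domain α)
    (h1 : Irrational p.1) (h2 : Irrational p.2) (hne : p.1 ≠ α) :
    ∃ q ∈ domain α, Irrational q.1 ∧ planarMap α q = p := by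
  have hpI := domain_subset hα hp
  have hp2 : 0 < p.2 := lt_of_le_of_ne hpI.2.1 h2.ne_zero.symm
  obtain ⟨M, hM⟩ := exists_nat_gt (2 / p.2 + 1)
  -- near `p` only finitely many branches occur
  have hmem : p ∈ ⋃ a ∈ (({1, -1} : Finset ℤ) ×ˢ Finset.Icc (1 : ℤ) M : Finset (ℤ × ℤ)),
      closure (branch a.1 a.2 '' {q ∈ orbits α | q.1 ≠ 0}) := by
    rw [← Finset.closure_biUnion]
    have hnh : {q : ℝ × ℝ | p.2 / 2 < q.2} ∈ nhds p :=
      (isOpen_lt continuous_const continuous_snd).mem_nhds (by simp; linarith)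
    rw [mem_closure_iff_nhds]
    intro t ht
    obtain ⟨s, ⟨hst, hs⟩, hso⟩ := mem_closure_iff_nhds.mp hp _ (Filter.inter_mem ht hnh)
    refine ⟨s, hst, ?_⟩
    have hs2 : p.2 / 2 < s.2 := hs
    rcases eq_or_exists_of_mem_orbits hso with h | ⟨q, hq, hq0, hsq⟩
    · linarith
    have hqI := domain_subset hα (orbits_subset_domain α hq)
    have hd1 := one_le_denom hα hqI.1 hq0 hqI.2
    have hd2 := one_le_digit hα hqI.1 hq0
    have hs' : s.2 = 1 / (digit α q.1 + sgn q.1 * q.2) := by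
      rw [hsq]; simp [planarMap, hq0]
    have hdM : digit α q.1 ≤ M := by
      have h3 : (digit α q.1 : ℝ) + sgn q.1 * q.2 ≤ 2 / p.2 := by
        rw [hs', lt_one_div (by positivity) (by linarith), one_div_div] at hs2
        exact hs2.le
      have h4 : -1 ≤ sgn q.1 * q.2 := by
        have := hqI.2.1
        have := hqI.2.2
        unfold sgn; split_ifs <;> linarith
      have : (digit α q.1 : ℝ) ≤ M := by linarith
      exact_mod_cast this
    simp only [mem_iUnion]
    refine ⟨(intSgn q.1, digit α q.1), ?_, q, ⟨hq, hq0⟩, ?_⟩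
    · simp only [Finset.mem_product, Finset.mem_Icc, hd2, hdM, and_self, and_true]
      unfold intSgn; split_ifs <;> simp
    · rw [hsq, planarMap_eq_branch hq0, ← intSgn_cast]
  simp only [mem_iUnion, Finset.mem_product, Finset.mem_Icc] at hmem
  obtain ⟨⟨ε, d⟩, ⟨hε, hd1, -⟩, hcl⟩ := hmem
  have hd1' : (1 : ℝ) ≤ d := by exact_mod_cast hd1
  have hε : (ε : ℝ) = 1 ∨ (ε : ℝ) = -1 := by
    simp only [Finset.mem_insert, Finset.mem_singleton] at hε
    rcases hε with rfl | rfl <;> simp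
  have hεε : (ε : ℝ) * ε = 1 := by rcases hε with h | h <;> rw [h] <;> norm_num
  have hpos : 0 < p.1 + d := by linarith [hpI.1.1, hα.1]
  have hc : ContinuousAt (invBranch ε d) p := by
    have := hpos.ne'
    have := hp2.ne'
    unfold invBranch
    fun_prop (disch := assumption)
  have hcl' := mem_closure_image hc hcl
  set q := invBranch ε d p with hq
  have hqΩ : q ∈ domain α := by
    refine closure_mono ?_ hcl'
    rintro _ ⟨_, ⟨s, ⟨hs, hs0⟩, rfl⟩, rfl⟩
    rwa [invBranch_branch hεε]
  have hqi : Irrational q.1 := by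
    have hi : Irrational (1 / (p.1 + d)) := by simpa using (h1.add_intCast d).inv
    change Irrational ((ε : ℝ) / (p.1 + d))
    rcases hε with h | h <;> rw [h]
    · exact hi
    · simpa [neg_div] using hi.neg
  have hsgn : sgn q.1 = ε := by
    change sgn ((ε : ℝ) / (p.1 + d)) = ε
    rcases hε with h | h <;> rw [h, sgn]
    · rw [if_pos (by positivity)]
    · rw [if_neg (not_le.mpr (div_neg_of_neg_of_pos (by norm_num) hpos))]
  -- The floor equals `d` because `α - 1 ≤ p.1 < α`; the right endpoint would give `d + 1`.
  have hdig : digit α q.1 = d := by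
    have habs : |1 / q.1| = p.1 + d := by
      rw [abs_one_div_eq, hsgn]
      change (ε : ℝ) / (ε / (p.1 + d)) = _
      rw [div_div_cancel₀ (left_ne_zero_of_mul_eq_one hεε)]
    rw [digit, habs, Int.floor_eq_iff]
    have := hpI.1.1
    have := lt_of_le_of_ne hpI.1.2 hne
    constructor <;> linarith
  refine ⟨q, hqΩ, hqi, ?_⟩
  rw [planarMap_eq_branch hqi.ne_zero, hsgn, hdig, hq, branch_invBranch hεε]

/-! ## The branches of `𝒯_α` preserve `μ` -/

/-- The derivative of `branch ε d` at `p`. -/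
noncomputable def branchDeriv (ε d : ℝ) (p : ℝ × ℝ) : ℝ × ℝ →L[ℝ] ℝ × ℝ :=
  (ContinuousLinearMap.toSpanSingleton ℝ (-ε / p.1 ^ 2)).prodMap
    (ContinuousLinearMap.toSpanSingleton ℝ (-ε / (d + ε * p.2) ^ 2))

theorem hasFDerivAt_branch {ε d : ℝ} {p : ℝ × ℝ} (h1 : p.1 ≠ 0) (h2 : d + ε * p.2 ≠ 0) :
    HasFDerivAt (branch ε d) (branchDeriv ε d p) p := by
  have e1 : HasDerivAt (fun x : ℝ => ε / x - d) (-ε / p.1 ^ 2) p.1 := by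
    have := (((hasDerivAt_id p.1).fun_inv h1).const_mul ε).sub_const d
    simpa [div_eq_mul_inv, neg_mul, mul_neg] using this
  have e2 : HasDerivAt (fun y : ℝ => 1 / (d + ε * y)) (-ε / (d + ε * p.2) ^ 2) p.2 := by
    have := (((hasDerivAt_id p.2).const_mul ε).const_add d).fun_inv h2
    simpa [one_div] using this
  exact e1.hasFDerivAt.prodMap p e2.hasFDerivAt

theorem det_branchDeriv (ε d : ℝ) (p : ℝ × ℝ) :
    (branchDeriv ε d p).det = (-ε / p.1 ^ 2) * (-ε / (d + ε * p.2) ^ 2) := by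
  have : (branchDeriv ε d p).toLinearMap = LinearMap.prodMap
      (ContinuousLinearMap.toSpanSingleton ℝ (-ε / p.1 ^ 2)).toLinearMap
      (ContinuousLinearMap.toSpanSingleton ℝ (-ε / (d + ε * p.2) ^ 2)).toLinearMap := rfl
  rw [ContinuousLinearMap.det, this, LinearMap.det_prodMap, LinearMap.det_ring,
    LinearMap.det_ring]
  simp

/-- If `(X, Y)` is the image of `(x, y)`, then `1 + X Y = ε (1 + x y) / (x (d + ε y))`, and the
Jacobian `1 / (x (d + ε y))^2` is exactly what the density loses. -/
theorem planeMeasure_image_branch {ε d : ℝ} (hε : ε * ε = 1) {s : Set (ℝ × ℝ)}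
    (hs : MeasurableSet s) (h1 : ∀ p ∈ s, p.1 ≠ 0) (h2 : ∀ p ∈ s, d + ε * p.2 ≠ 0)
    (h3 : ∀ p ∈ s, 1 + p.1 * p.2 ≠ 0) :
    planeMeasure (branch ε d '' s) = planeMeasure s := by
  have hinj : InjOn (branch ε d) s := fun p hp q hq h => by
    rw [← invBranch_branch (d := d) hε p, h, invBranch_branch hε]
  have hd : ∀ p ∈ s, HasFDerivWithinAt (branch ε d) (branchDeriv ε d p) s p := fun p hp =>
    (hasFDerivAt_branch (h1 p hp) (h2 p hp)).hasFDerivWithinAt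
  have him : MeasurableSet (branch ε d '' s) := measurable_image_of_fderivWithin hs hd hinj
  rw [planeMeasure, withDensity_apply _ him, withDensity_apply _ hs,
    lintegral_image_eq_lintegral_abs_det_fderiv_mul _ hs hd hinj]
  refine setLIntegral_congr_fun hs fun p hp => ?_
  have e1 := h1 p hp
  have e2 := h2 p hp
  have e3 := h3 p hp
  have hε0 : ε ≠ 0 := left_ne_zero_of_mul_eq_one hε
  rw [← ENNReal.ofReal_mul (abs_nonneg _), det_branchDeriv]
  congr 1
  have habs : (-ε / p.1 ^ 2) * (-ε / (d + ε * p.2) ^ 2) = 1 / (p.1 * (d + ε * p.2)) ^ 2 := by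
    rw [div_mul_div_comm, neg_mul_neg, hε]; ring
  have hb : 1 + (branch ε d p).1 * (branch ε d p).2
      = ε * (1 + p.1 * p.2) / (p.1 * (d + ε * p.2)) := by
    simp only [branch]; field_simp; ring
  rw [habs, hb, abs_of_nonneg (by positivity), div_pow, mul_pow ε, pow_two ε, hε, one_mul]
  field_simp

/-! ## `𝒯_α` preserves `μ` on `Ω_α` and is injective off a null set -/

/-- The points of `Ω_α` with irrational first coordinate that `𝒯_α` keeps in `Ω_α`. -/
def core (α : ℝ) : Set (ℝ × ℝ) :=
  {p | p ∈ domain α ∧ Irrational p.1 ∧ planarMap α p ∈ domain α}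

/-- The part of `core α` with given sign and digit. -/
def piece (α : ℝ) (a : ℤ × ℤ) : Set (ℝ × ℝ) :=
  core α ∩ {p | (intSgn p.1, digit α p.1) = a}

theorem measurableSet_core (α : ℝ) : MeasurableSet (core α) := by
  have h1 : MeasurableSet {x : ℝ | Irrational x} := (countable_range _).measurableSet.compl
  exact (measurableSet_domain α).inter ((measurable_fst h1).inter
    (measurable_planarMap α (measurableSet_domain α)))

theorem measurableSet_piece (α : ℝ) (a : ℤ × ℤ) : MeasurableSet (piece α a) := by
  refine (measurableSet_core α).inter ?_
  have : Measurable fun p : ℝ × ℝ => (intSgn p.1, digit α p.1) :=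
    (measurable_intSgn.comp measurable_fst).prodMk ((measurable_digit α).comp measurable_fst)
  exact this (measurableSet_singleton a)

theorem iUnion_piece (α : ℝ) : ⋃ a, piece α a = core α := by
  ext p; simp [piece]

theorem pairwise_disjoint_piece (α : ℝ) : Pairwise (Function.onFun Disjoint (piece α)) := by
  intro a b hab
  rw [Function.onFun, Set.disjoint_left]
  rintro p ⟨-, h1⟩ ⟨-, h2⟩
  exact hab (h1.symm.trans h2)

theorem planarMap_eq_of_mem_piece {α : ℝ} {a : ℤ × ℤ} {p : ℝ × ℝ} (hp : p ∈ piece α a) :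
    planarMap α p = branch a.1 a.2 p := by
  obtain ⟨⟨-, hi, -⟩, rfl⟩ := hp
  rw [planarMap_eq_branch hi.ne_zero, intSgn_cast]

theorem fst_mul_self_of_mem_piece {α : ℝ} {a : ℤ × ℤ} {p : ℝ × ℝ} (hp : p ∈ piece α a) :
    (a.1 : ℝ) * a.1 = 1 := by
  obtain ⟨-, rfl⟩ := hp
  rw [intSgn_cast, sgn_mul_self]

theorem injOn_piece (α : ℝ) (a : ℤ × ℤ) : InjOn (planarMap α) (piece α a) := by
  intro p hp q hq h
  have hε := fst_mul_self_of_mem_piece hp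
  rw [planarMap_eq_of_mem_piece hp, planarMap_eq_of_mem_piece hq] at h
  rw [← invBranch_branch (d := a.2) hε p, h, invBranch_branch hε]

theorem measurableSet_image_piece {α : ℝ} {a : ℤ × ℤ} {s : Set (ℝ × ℝ)} (hs : MeasurableSet s)
    (hsub : s ⊆ piece α a) : MeasurableSet (planarMap α '' s) :=
  hs.image_of_measurable_injOn (measurable_planarMap α) ((injOn_piece α a).mono hsub)

theorem planeMeasure_image_piece {α : ℝ} (hα : α ∈ Ioc (0 : ℝ) 1) {a : ℤ × ℤ} {s : Set (ℝ × ℝ)}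
    (hs : MeasurableSet s) (hsub : s ⊆ piece α a) :
    planeMeasure (planarMap α '' s) = planeMeasure s := by
  rcases s.eq_empty_or_nonempty with rfl | ⟨p₀, hp₀⟩
  · simp
  rw [image_congr fun p hp => planarMap_eq_of_mem_piece (hsub hp)]
  refine planeMeasure_image_branch (fst_mul_self_of_mem_piece (hsub hp₀)) hs
    (fun p hp => (hsub hp).1.2.1.ne_zero) (fun p hp => ?_) fun p hp => ?_
  · obtain ⟨⟨hΩ, hi, -⟩, rfl⟩ := hsub hp
    have hI := domain_subset hα hΩ
    have := one_le_denom hα hI.1 hi.ne_zero hI.2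
    rw [intSgn_cast]
    linarith
  · have hI := domain_subset hα (hsub hp).1.1
    have := le_one_add_mul hα hI.1 hI.2
    have := hα.1
    linarith

theorem planarMap_image_piece_subset (α : ℝ) (a : ℤ × ℤ) :
    planarMap α '' piece α a ⊆ domain α := by
  rintro _ ⟨p, hp, rfl⟩
  exact hp.1.2.2

theorem ae_mem_core {α : ℝ} (hα : α ∈ Ioc (0 : ℝ) 1) :
    ∀ᵐ p ∂planeMeasure.restrict (domain α), p ∈ core α := by
  rw [ae_restrict_iff' (measurableSet_domain α)]
  filter_upwards [ae_irrational_fst, ae_planarMap_mem_domain hα] with p h1 h2 h3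
  exact ⟨h3, h1, h2 h3⟩

/-- The number of preimages in `core α`. -/
noncomputable def multiplicity (α : ℝ) (p : ℝ × ℝ) : ENNReal :=
  ∑' a, (planarMap α '' piece α a).indicator 1 p

theorem measurable_multiplicity (α : ℝ) : Measurable (multiplicity α) := by
  unfold multiplicity
  exact Measurable.tsum fun a => measurable_one.indicator
    (measurableSet_image_piece (measurableSet_piece α a) subset_rfl)

/-- The pieces partition `core α`, and on each of them the map is injective and preserves `μ`;
summing over the pieces counts preimages. -/
theorem setLIntegral_multiplicity {α : ℝ} (hα : α ∈ Ioc (0 : ℝ) 1) {B : Set (ℝ × ℝ)}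
    (hB : MeasurableSet B) :
    ∫⁻ p in B, multiplicity α p ∂planeMeasure.restrict (domain α) =
      planeMeasure.restrict (domain α) (planarMap α ⁻¹' B) := by
  have him := fun a => measurableSet_image_piece (measurableSet_piece α a) subset_rfl
  have hpre : MeasurableSet (planarMap α ⁻¹' B) := measurable_planarMap α hB
  calc _ = ∑' a, planeMeasure (planarMap α '' (piece α a ∩ planarMap α ⁻¹' B)) := by
        unfold multiplicity
        rw [lintegral_tsum fun a => (measurable_one.indicator (him a)).aemeasurable]
        congr 1 with a
        rw [lintegral_indicator_one (him a), Measure.restrict_apply (him a),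
          Measure.restrict_apply ((him a).inter hB), image_inter_preimage,
          inter_eq_left.mpr (inter_subset_left.trans (planarMap_image_piece_subset α a))]
    _ = ∑' a, planeMeasure (piece α a ∩ planarMap α ⁻¹' B) := by
        congr 1 with a
        exact planeMeasure_image_piece hα ((measurableSet_piece α a).inter hpre) inter_subset_left
    _ = planeMeasure (core α ∩ planarMap α ⁻¹' B) := by
        rw [← iUnion_piece, iUnion_inter, measure_iUnion]
        · exact fun a b hab => (pairwise_disjoint_piece α hab).mono inter_subset_left
            inter_subset_left
        · exact fun a => (measurableSet_piece α a).inter hpre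
    _ = _ := by
        rw [Measure.restrict_apply hpre]
        refine measure_congr ?_
        have h := (ae_restrict_iff' (measurableSet_domain α)).mp (ae_mem_core hα)
        filter_upwards [h] with p hp
        apply propext
        exact ⟨fun h => ⟨h.2, h.1.1⟩, fun h => ⟨hp h.2, h.1⟩⟩

/-- Surjectivity gives the lower bound 1, and the total integral is the finite mass of `Ω_α`, which
leaves no room for an excess. -/
theorem ae_multiplicity_eq_one {α : ℝ} (hα : α ∈ Ioc (0 : ℝ) 1) :
    ∀ᵐ p ∂planeMeasure.restrict (domain α), multiplicity α p = 1 := by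
  have hge : (fun _ => 1) ≤ᵐ[planeMeasure.restrict (domain α)] multiplicity α := by
    rw [Filter.EventuallyLE, ae_restrict_iff' (measurableSet_domain α)]
    filter_upwards [ae_irrational_fst, ae_irrational_snd,
      ae_fst_notMem (countable_singleton α)] with p h1 h2 h3 hp
    obtain ⟨q, hq, hqi, rfl⟩ := exists_planarMap_eq hα hp h1 h2 h3
    have hmem : q ∈ piece α (intSgn q.1, digit α q.1) := ⟨⟨hq, hqi, hp⟩, rfl⟩
    refine le_trans ?_ (ENNReal.le_tsum (intSgn q.1, digit α q.1))
    rw [indicator_of_mem (mem_image_of_mem _ hmem)]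
    rfl
  have htot := setLIntegral_multiplicity hα MeasurableSet.univ
  rw [Measure.restrict_univ, preimage_univ, Measure.restrict_apply_univ] at htot
  have := ae_eq_of_ae_le_of_lintegral_le hge
    (by simpa using planeMeasure_domain_ne_top hα) (measurable_multiplicity α).aemeasurable
    (by rw [htot]; simp)
  filter_upwards [this] with p hp using hp.symm

theorem measurePreserving_planarMap {α : ℝ} (hα : α ∈ Ioc (0 : ℝ) 1) :
    MeasurePreserving (planarMap α) (planeMeasure.restrict (domain α))
      (planeMeasure.restrict (domain α)) := by
  refine ⟨measurable_planarMap α, Measure.ext fun B hB => ?_⟩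
  rw [Measure.map_apply (measurable_planarMap α) hB, ← setLIntegral_multiplicity hα hB,
    lintegral_congr_ae (ae_restrict_of_ae (ae_multiplicity_eq_one hα)), setLIntegral_one]

/-- A set of full measure in `Ω_α` on which `𝒯_α` is injective. -/
def injCore (α : ℝ) : Set (ℝ × ℝ) := {p | p ∈ core α ∧ multiplicity α (planarMap α p) = 1}

theorem measurableSet_injCore (α : ℝ) : MeasurableSet (injCore α) :=
  (measurableSet_core α).inter
    (((measurable_multiplicity α).comp (measurable_planarMap α)) (measurableSet_singleton 1))

theorem ae_mem_injCore {α : ℝ} (hα : α ∈ Ioc (0 : ℝ) 1) :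
    ∀ᵐ p ∂planeMeasure.restrict (domain α), p ∈ injCore α := by
  filter_upwards [ae_mem_core hα, (measurePreserving_planarMap hα).quasiMeasurePreserving.ae
    (ae_multiplicity_eq_one hα)] with p h1 h2 using ⟨h1, h2⟩

theorem injOn_injCore (α : ℝ) : InjOn (planarMap α) (injCore α) := by
  rintro p ⟨hp, hm⟩ q ⟨hq, -⟩ h
  set a := (intSgn p.1, digit α p.1)
  set b := (intSgn q.1, digit α q.1)
  have hpa : p ∈ piece α a := ⟨hp, rfl⟩
  have hqb : q ∈ piece α b := ⟨hq, rfl⟩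
  by_cases hab : a = b
  · rw [← hab] at hqb
    exact injOn_piece α a hpa hqb h
  · exfalso
    -- Preimages in two different pieces would make the multiplicity at least 2.
    have hle : ∑ c ∈ {a, b}, (planarMap α '' piece α c).indicator (1 : ℝ × ℝ → ENNReal) (planarMap α p)
        ≤ multiplicity α (planarMap α p) := ENNReal.sum_le_tsum _
    rw [Finset.sum_pair hab, indicator_of_mem (mem_image_of_mem _ hpa), h,
      indicator_of_mem (mem_image_of_mem _ hqb), ← h, hm] at hle
    simp only [Pi.one_apply] at hle
    norm_num at hle

end AlphaCF

/-- A measure-preserving map of a standard Borel probability space that is injective on a set of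
full measure is invertible modulo null sets. -/
theorem exists_isAEInverse_of_injOn {X : Type u} [MeasurableSpace X] [StandardBorelSpace X]
    {μ : Measure X} [IsProbabilityMeasure μ] {S : X → X} (hS : MeasurePreserving S μ μ)
    {s : Set X} (hs : MeasurableSet s) (hμ : ∀ᵐ x ∂μ, x ∈ s) (hinj : InjOn S s) :
    ∃ R, IsAEInverse μ S R := by
  have := hs.standardBorel
  obtain ⟨x₀, hx₀⟩ := hμ.exists
  -- By Lusin–Souslin, an injective measurable map between standard Borel spaces is an embedding, so
  -- its inverse extends measurably to the whole space.
  have hg : MeasurableEmbedding fun x : s => S x :=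
    (hS.measurable.comp measurable_subtype_coe).measurableEmbedding
      fun x y h => Subtype.ext (hinj x.2 y.2 h)
  obtain ⟨R, hR, hRS⟩ := hg.exists_measurable_extend measurable_subtype_coe fun _ => ⟨x₀⟩
  have hleft : ∀ᵐ x ∂μ, R (S x) = x := by
    filter_upwards [hμ] with x hx
    exact congr_fun hRS ⟨x, hx⟩
  refine ⟨R, hS, ⟨hR, ?_⟩, hleft, ?_⟩
  · nth_rewrite 1 [← hS.map_eq]
    rw [Measure.map_map hR hS.measurable, Measure.map_congr (f := R ∘ S) (g := id) hleft, Measure.map_id]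
  · have hmeas : MeasurableSet {x | S (R x) = x} :=
      measurableSet_eq_fun (hS.measurable.comp hR) measurable_id
    rw [← hS.map_eq, ae_map_iff hS.measurable.aemeasurable hmeas]
    filter_upwards [hleft] with x hx
    rw [hx]

namespace AlphaCF

/-! ## The two probability measures -/

/-- The normalization of `μ` on `Ω_α`, as a measure on the plane. -/
noncomputable def planeProb (α : ℝ) : Measure (ℝ × ℝ) :=
  (planeMeasure (domain α))⁻¹ • planeMeasure.restrict (domain α)

theorem map_val_domainMeasure (α : ℝ) :
    (domainMeasure α).map Subtype.val = planeProb α := by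
  rw [domainMeasure, Measure.map_smul, map_comap_subtype_coe (measurableSet_domain α), planeProb]

theorem measurePreserving_val (α : ℝ) :
    MeasurePreserving (Subtype.val : domain α → ℝ × ℝ) (domainMeasure α) (planeProb α) :=
  ⟨measurable_subtype_coe, map_val_domainMeasure α⟩

theorem isProbabilityMeasure_planeProb {α : ℝ} (hα : α ∈ Ioc (0 : ℝ) 1) :
    IsProbabilityMeasure (planeProb α) := by
  refine ⟨?_⟩
  rw [planeProb, Measure.smul_apply, Measure.restrict_apply_univ, smul_eq_mul]
  exact ENNReal.inv_mul_cancel (planeMeasure_domain_ne_zero hα) (planeMeasure_domain_ne_top hα)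

theorem isProbabilityMeasure_domainMeasure {α : ℝ} (hα : α ∈ Ioc (0 : ℝ) 1) :
    IsProbabilityMeasure (domainMeasure α) := by
  have := isProbabilityMeasure_planeProb hα
  refine ⟨?_⟩
  rw [← measure_univ (μ := planeProb α), ← (measurePreserving_val α).measure_preimage
    MeasurableSet.univ.nullMeasurableSet, preimage_univ]

theorem ae_domainMeasure {α : ℝ} {P : ℝ × ℝ → Prop}
    (h : ∀ᵐ p ∂planeMeasure.restrict (domain α), P p) :
    ∀ᵐ p : domain α ∂domainMeasure α, P p :=
  (measurePreserving_val α).quasiMeasurePreserving.ae (Measure.ae_smul_measure h _)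

theorem measurePreserving_planeProb {α : ℝ} (hα : α ∈ Ioc (0 : ℝ) 1) :
    MeasurePreserving (planarMap α) (planeProb α) (planeProb α) :=
  (measurePreserving_planarMap hα).smul_measure _

theorem domainMap_val {α : ℝ} {p : domain α} (h : planarMap α p ∈ domain α) :
    (domainMap α p : ℝ × ℝ) = planarMap α p := by
  rw [domainMap, dif_pos h]

theorem measurable_domainMap (α : ℝ) : Measurable (domainMap α) := by
  classical
  have hm : Measurable fun p : domain α => planarMap α p :=
    (measurable_planarMap α).comp measurable_subtype_coe
  have hs : MeasurableSet {p : domain α | planarMap α p ∈ domain α} := hm (measurableSet_domain α)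
  rw [← (MeasurableEmbedding.subtype_coe (measurableSet_domain α)).measurable_comp_iff]
  have : Subtype.val ∘ domainMap α =
      fun p : domain α => if planarMap α p ∈ domain α then planarMap α p else (p : ℝ × ℝ) := by
    funext p
    simp only [Function.comp_apply, domainMap]
    split_ifs <;> rfl
  rw [this]
  exact Measurable.ite hs hm measurable_subtype_coe

theorem ae_domainMap_val {α : ℝ} (hα : α ∈ Ioc (0 : ℝ) 1) :
    ∀ᵐ p ∂domainMeasure α, (domainMap α p : ℝ × ℝ) = planarMap α p := by
  filter_upwards [ae_domainMeasure (ae_mem_core hα)] with p hp using domainMap_val hp.2.2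

theorem measurePreserving_domainMap {α : ℝ} (hα : α ∈ Ioc (0 : ℝ) 1) :
    MeasurePreserving (domainMap α) (domainMeasure α) (domainMeasure α) := by
  refine ⟨measurable_domainMap α, ?_⟩
  have he := MeasurableEmbedding.subtype_coe (measurableSet_domain α)
  rw [← he.comap_map ((domainMeasure α).map (domainMap α)), ← he.comap_map (domainMeasure α)]
  congr 1
  rw [he.comap_map, Measure.map_map he.measurable (measurable_domainMap α),
    Measure.map_congr (f := Subtype.val ∘ domainMap α) (g := planarMap α ∘ Subtype.val)
      (ae_domainMap_val hα),
    ← Measure.map_map (measurable_planarMap α) he.measurable, map_val_domainMeasure,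
    (measurePreserving_planeProb hα).map_eq]

theorem exists_isAEInverse_domainMap {α : ℝ} (hα : α ∈ Ioc (0 : ℝ) 1) :
    ∃ R, IsAEInverse (domainMeasure α) (domainMap α) R := by
  have := (measurableSet_domain α).standardBorel
  have := isProbabilityMeasure_domainMeasure hα
  refine exists_isAEInverse_of_injOn (measurePreserving_domainMap hα)
    (s := Subtype.val ⁻¹' injCore α) (measurable_subtype_coe (measurableSet_injCore α))
    (ae_domainMeasure (ae_mem_injCore hα)) fun p hp q hq h => ?_
  refine Subtype.ext (injOn_injCore α hp hq ?_)
  rw [← domainMap_val hp.1.2.2, ← domainMap_val hq.1.2.2, h]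

theorem measurable_proj {α : ℝ} (hα : α ∈ Ioc (0 : ℝ) 1) : Measurable (proj hα) :=
  (measurable_fst.comp measurable_subtype_coe).subtype_mk

theorem map_proj_domainMeasure {α : ℝ} (hα : α ∈ Ioc (0 : ℝ) 1) :
    (domainMeasure α).map (proj hα) = intervalMeasure α := by
  have hI : MeasurableSet (interval α) := measurableSet_Icc
  have he := MeasurableEmbedding.subtype_coe hI
  have hΩ := measurableSet_domain α
  rw [← he.comap_map ((domainMeasure α).map (proj hα)), intervalMeasure]
  ext A hA
  obtain ⟨A, hA', rfl⟩ := hA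
  rw [he.comap_apply, he.comap_apply, Subtype.image_preimage_coe]
  set A' := interval α ∩ A with hA'def
  have hAm : MeasurableSet A' := hI.inter hA'
  have hfib : ∀ x, MeasurableSet {y : ℝ | (x, y) ∈ domain α} := fun x =>
    (by fun_prop : Measurable fun y : ℝ => (x, y)) hΩ
  rw [Measure.map_map he.measurable (measurable_proj hα)]
  change Measure.map (Prod.fst ∘ Subtype.val) _ _ = _
  rw [← Measure.map_map measurable_fst measurable_subtype_coe, map_val_domainMeasure,
    Measure.map_apply measurable_fst hAm, planeProb, Measure.smul_apply,
    Measure.restrict_apply (measurable_fst hAm), planeMeasure,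
    withDensity_apply _ ((measurable_fst hAm).inter hΩ), withDensity_apply _ hAm, smul_eq_mul]
  set F : ℝ × ℝ → ENNReal := (domain α).indicator
    fun p => ENNReal.ofReal (1 / (1 + p.1 * p.2) ^ 2) with hF
  have hFm : Measurable F := measurable_density.indicator hΩ
  have hfibF : ∀ x, ∫⁻ y in {y : ℝ | (x, y) ∈ domain α}, ENNReal.ofReal (1 / (1 + x * y) ^ 2)
      = ∫⁻ y, F (x, y) := fun x => by
    rw [← lintegral_indicator (hfib x)]
    rfl
  simp only [hfibF]
  rw [lintegral_const_mul _ hFm.lintegral_prod_right']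
  congr 1
  rw [inter_comm, ← setLIntegral_indicator hΩ, ← prod_univ, Measure.volume_eq_prod,
    ← Measure.prod_restrict, Measure.restrict_univ, lintegral_prod _ hFm.aemeasurable]

open Filter Topology

/-! ## Points of the plane from backward orbits -/

/-- `x` is a backward orbit of `T_α` through irrational points of `[α - 1, α)`. -/
structure IsBackwardOrbit (α : ℝ) (x : ℕ → ℝ) : Prop where
  mem : ∀ n, x n ∈ Ico (α - 1) α
  irrational : ∀ n, Irrational (x n)
  map_eq : ∀ n, map α (x (n + 1)) = x n

/-- The points `𝒯_α^n (x_n, 0)`. -/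
noncomputable def approx (α : ℝ) (x : ℕ → ℝ) (n : ℕ) : ℝ × ℝ := (planarMap α)^[n] (x n, 0)

/-- The point `(x_0, y)` with past `x`, where `y` is the limit of the second coordinates of
`𝒯_α^n (x_n, 0)`. -/
noncomputable def limitPoint (α : ℝ) (x : ℕ → ℝ) : ℝ × ℝ :=
  (x 0, limsup (fun n => (approx α x n).2) atTop)

theorem measurable_approx (α : ℝ) (n : ℕ) : Measurable fun x : ℕ → ℝ => approx α x n :=
  ((measurable_planarMap α).iterate n).comp
    ((measurable_pi_apply n).prodMk measurable_const)

/-- The upper limit is defined for every sequence, so measurability needs no restriction to backward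
orbits. -/
theorem measurable_limitPoint (α : ℝ) : Measurable (limitPoint α) :=
  (measurable_pi_apply 0).prodMk
    (Measurable.limsup fun n => measurable_snd.comp (measurable_approx α n))

theorem IsBackwardOrbit.iterate_eq {α : ℝ} {x : ℕ → ℝ} (hx : IsBackwardOrbit α x) (n k : ℕ) :
    (map α)^[k] (x (n + k)) = x n := by
  induction k with
  | zero => rfl
  | succ k ih => rw [Function.iterate_succ_apply, ← add_assoc, hx.map_eq, ih]

theorem IsBackwardOrbit.approx_fst {α : ℝ} {x : ℕ → ℝ} (hx : IsBackwardOrbit α x) (n : ℕ) :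
    (approx α x n).1 = x 0 := by
  rw [approx, planarMap_iterate_fst]
  simpa using hx.iterate_eq 0 n

theorem IsBackwardOrbit.tendsto_approx_fst {α : ℝ} {x : ℕ → ℝ} (hx : IsBackwardOrbit α x) :
    Tendsto (fun n => (approx α x n).1) atTop (𝓝 (x 0)) := by
  simp only [hx.approx_fst]
  exact tendsto_const_nhds

theorem IsBackwardOrbit.approx_mem {α : ℝ} {x : ℕ → ℝ} (hx : IsBackwardOrbit α x) (n : ℕ) :
    approx α x n ∈ domain α :=
  iterate_mem_domain (hx.mem n) n

theorem IsBackwardOrbit.tendsto {α : ℝ} (hα : α ∈ Ioc (0 : ℝ) 1) {x : ℕ → ℝ}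
    (hx : IsBackwardOrbit α x) : Tendsto (approx α x) atTop (𝓝 (limitPoint α x)) := by
  have hI := fun n => Ico_subset_Icc_self (hx.mem n)
  have hcauchy : CauchySeq fun n => (approx α x n).2 := by
    rw [Metric.cauchySeq_iff']
    intro ε hε
    obtain ⟨n₀, hn₀⟩ := exists_abs_iterate_snd_sub_le hα (half_pos hε)
    refine ⟨n₀, fun n hn => ?_⟩
    obtain ⟨k, rfl⟩ := Nat.exists_eq_add_of_le hn
    -- All later approximants are `n₀`-th images of points above the same `x n₀`, so they are close
    -- to one another by forgetfulness.
    have hsplit : approx α x (n₀ + k)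
        = (planarMap α)^[n₀] (x n₀, ((planarMap α)^[k] (x (n₀ + k), 0)).2) := by
      rw [approx, Function.iterate_add_apply]
      congr 1
      refine Prod.ext ?_ rfl
      rw [planarMap_iterate_fst]
      exact hx.iterate_eq n₀ k
    rw [Real.dist_eq, hsplit]
    refine (hn₀ n₀ le_rfl _ (hI n₀) (hx.irrational n₀) _
      (planarMap_iterate_snd_mem hα (hI _) (by simp) k)).trans_lt (half_lt_self hε)
  obtain ⟨y, hy⟩ := cauchySeq_tendsto_of_complete hcauchy
  rw [limitPoint, hy.limsup_eq]
  exact hx.tendsto_approx_fst.prodMk_nhds hy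

theorem IsBackwardOrbit.limitPoint_mem {α : ℝ} (hα : α ∈ Ioc (0 : ℝ) 1) {x : ℕ → ℝ}
    (hx : IsBackwardOrbit α x) : limitPoint α x ∈ domain α :=
  (isClosed_domain α).mem_of_tendsto (hx.tendsto hα) (Eventually.of_forall hx.approx_mem)

/-- The `n`-th image of `p n` is always `p 0`, and it differs little from the `n`-th image of `(x n,
0)`, which starts above the same point. -/
theorem IsBackwardOrbit.limitPoint_eq {α : ℝ} (hα : α ∈ Ioc (0 : ℝ) 1) {x : ℕ → ℝ}
    (hx : IsBackwardOrbit α x) {p : ℕ → ℝ × ℝ} (hfst : ∀ n, (p n).1 = x n)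
    (hsnd : ∀ n, (p n).2 ∈ Icc (0 : ℝ) 1) (hp : ∀ n, planarMap α (p (n + 1)) = p n) :
    limitPoint α x = p 0 := by
  have hiter : ∀ n, (planarMap α)^[n] (p n) = p 0 := by
    intro n
    induction n with
    | zero => rfl
    | succ n ih => rw [Function.iterate_succ_apply, hp, ih]
  refine tendsto_nhds_unique (hx.tendsto hα) ?_
  have h2 : Tendsto (fun n => (approx α x n).2) atTop (𝓝 (p 0).2) := by
    rw [Metric.tendsto_atTop]
    intro ε hε
    obtain ⟨n₀, hn₀⟩ := exists_abs_iterate_snd_sub_le hα (half_pos hε)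
    refine ⟨n₀, fun n hn => ?_⟩
    have h := hn₀ n hn (x n) (Ico_subset_Icc_self (hx.mem n)) (hx.irrational n) _ (hsnd n)
    rw [← hfst n, Prod.mk.eta, hiter n, abs_sub_comm, hfst n] at h
    rw [Real.dist_eq]
    exact h.trans_lt (half_lt_self hε)
  have h1 : (p 0).1 = x 0 := hfst 0
  rw [← Prod.mk.eta (p := p 0), h1]
  exact hx.tendsto_approx_fst.prodMk_nhds h2

/-- Adding one more point to a backward orbit amounts to applying `𝒯_α` to its limit point. -/
theorem IsBackwardOrbit.planarMap_limitPoint {α : ℝ} (hα : α ∈ Ioc (0 : ℝ) 1) {x : ℕ → ℝ}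
    (hx : IsBackwardOrbit α fun n => x (n + 1)) (hx' : IsBackwardOrbit α x) :
    planarMap α (limitPoint α fun n => x (n + 1)) = limitPoint α x := by
  set z : ℕ → ℝ := fun n => x (n + 1) with hz
  have hΩ := domain_subset hα (hx.limitPoint_mem hα)
  have hz0 : z 0 ≠ 0 := (hx.irrational 0).ne_zero
  have hsucc : ∀ n, approx α x (n + 1) = planarMap α (approx α z n) := fun n =>
    Function.iterate_succ_apply' ..
  refine tendsto_nhds_unique ?_ ((hx'.tendsto hα).comp (tendsto_add_atTop_nat 1))
  -- The approximants all lie on one vertical line, so a single branch, continuous at the limit,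
  -- acts on them. Continuity of `𝒯_α` itself is not needed.
  have hfun : approx α x ∘ (fun n => n + 1) = fun n =>
      branch (sgn (z 0)) (digit α (z 0)) (approx α z n) := by
    funext n
    have h0 : (approx α z n).1 ≠ 0 := by rwa [hx.approx_fst]
    rw [Function.comp_apply, hsucc, planarMap_eq_branch h0, hx.approx_fst]
  have hl0 : (limitPoint α z).1 = z 0 := rfl
  rw [hfun, planarMap_eq_branch (by rwa [hl0]), hl0]
  have hd := one_le_denom hα hΩ.1 (by rwa [hl0]) hΩ.2
  rw [hl0] at hd
  have hc : ContinuousAt (branch (sgn (z 0)) (digit α (z 0))) (limitPoint α z) := by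
    have h1 : (limitPoint α z).1 ≠ 0 := by rwa [hl0]
    have h2 : (digit α (z 0) : ℝ) + sgn (z 0) * (limitPoint α z).2 ≠ 0 := by linarith
    unfold branch
    fun_prop (disch := assumption)
  exact hc.tendsto.comp (hx.tendsto hα)

/-! ## Natural extension -/

/-- The bottom edge lies in `Ω_α`; its right endpoint is gained by taking the closure. -/
theorem surjective_proj {α : ℝ} (hα : α ∈ Ioc (0 : ℝ) 1) : Function.Surjective (proj hα) := by
  have hsub : Icc (α - 1) α ⊆ {x : ℝ | (x, (0 : ℝ)) ∈ domain α} := by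
    rw [← closure_Ico (by linarith : α - 1 ≠ α)]
    exact closure_minimal (fun x hx => iterate_mem_domain hx 0)
      ((isClosed_domain α).preimage (by fun_prop))
  rintro ⟨x, hx⟩
  exact ⟨⟨(x, 0), hsub hx⟩, rfl⟩

theorem measurePreserving_proj {α : ℝ} (hα : α ∈ Ioc (0 : ℝ) 1) :
    MeasurePreserving (proj hα) (domainMeasure α) (intervalMeasure α) :=
  ⟨measurable_proj hα, map_proj_domainMeasure hα⟩

theorem proj_domainMap {α : ℝ} (hα : α ∈ Ioc (0 : ℝ) 1) :
    ∀ᵐ p ∂domainMeasure α, proj hα (domainMap α p) = intervalMap hα (proj hα p) := by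
  filter_upwards [ae_domainMap_val hα] with p hp
  apply Subtype.ext
  change (domainMap α p : ℝ × ℝ).1 = map α p.1.1
  rw [hp]
  rfl

theorem isFactorMap_proj {α : ℝ} (hα : α ∈ Ioc (0 : ℝ) 1) :
    IsFactorMap (domainMap α) (domainMeasure α) (intervalMap hα) (intervalMeasure α) (proj hα) :=
  ⟨measurePreserving_proj hα, proj_domainMap hα⟩

theorem measurable_intervalMap {α : ℝ} (hα : α ∈ Ioc (0 : ℝ) 1) : Measurable (intervalMap hα) :=
  ((measurable_map α).comp measurable_subtype_coe).subtype_mk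

end AlphaCF

/-- A factor of a measure-preserving system is measure-preserving. -/
theorem IsFactorMap.base_measurePreserving {X : Type u} {Y : Type v} [MeasurableSpace X]
    [MeasurableSpace Y] {S : X → X} {μ : Measure X} {T : Y → Y} {ν : Measure Y} {π : X → Y}
    (h : IsFactorMap S μ T ν π) (hS : MeasurePreserving S μ μ) (hT : Measurable T) :
    MeasurePreserving T ν ν := by
  refine ⟨hT, ?_⟩
  have hπ := h.measurePreserving
  rw [← hπ.map_eq, Measure.map_map hT hπ.measurable,
    Measure.map_congr (f := T ∘ π) (g := π ∘ S) (h.semiconj.mono fun x hx => hx.symm),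
    ← Measure.map_map hπ.measurable hS.measurable, hS.map_eq]

namespace AlphaCF

open Filter Topology

theorem ae_intervalMeasure_mem {α : ℝ} (hα : α ∈ Ioc (0 : ℝ) 1) :
    ∀ᵐ x : interval α ∂intervalMeasure α, (x : ℝ) ∈ Ico (α - 1) α ∧ Irrational (x : ℝ) := by
  have h : ∀ᵐ p : domain α ∂domainMeasure α,
      (proj hα p : ℝ) ∈ Ico (α - 1) α ∧ Irrational (proj hα p : ℝ) := by
    refine ae_domainMeasure (P := fun p => p.1 ∈ Ico (α - 1) α ∧ Irrational p.1) ?_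
    rw [ae_restrict_iff' (measurableSet_domain α)]
    filter_upwards [ae_irrational_fst, ae_fst_notMem (countable_singleton α)] with p h1 h2 hp
    have hI := (domain_subset hα hp).1
    exact ⟨⟨hI.1, lt_of_le_of_ne hI.2 h2⟩, h1⟩
  rw [← map_proj_domainMeasure hα, ae_map_iff (measurable_proj hα).aemeasurable]
  · exact h
  · have h1 : MeasurableSet {x : ℝ | Irrational x} := (countable_range _).measurableSet.compl
    exact measurable_subtype_coe (measurableSet_Ico.inter h1)

/-! ### Invertible extensions and the limit points of their pasts -/

section Extension

variable {Z : Type u} {U V : Z → Z}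

/-- The past of `z`, seen through `ψ`. -/
def past {α : ℝ} (V : Z → Z) (ψ : Z → interval α) (z : Z) (n : ℕ) : ℝ := ψ (V^[n] z)

theorem measurable_past {α : ℝ} {m : MeasurableSpace Z} {ψ : Z → interval α}
    (h : ∀ n, Measurable fun z => ψ (V^[n] z)) : Measurable (past V ψ) :=
  measurable_pi_lambda _ fun n => measurable_subtype_coe.comp (h n)

/-- The σ-algebra is left free so that the lemma also applies to the join generated by the past. -/
theorem measurable_limitPoint_past {α : ℝ} {m : MeasurableSpace Z} {ψ : Z → interval α}
    (h : ∀ n, Measurable fun z => ψ (V^[n] z)) :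
    Measurable fun z => limitPoint α (past V ψ z) :=
  (measurable_limitPoint α).comp (measurable_past h)

variable [MeasurableSpace Z] {ρ : Measure Z}

theorem ae_isBackwardOrbit {α : ℝ} (hα : α ∈ Ioc (0 : ℝ) 1) (hU : IsAEInverse ρ U V)
    {ψ : Z → interval α} (hψ : IsFactorMap U ρ (intervalMap hα) (intervalMeasure α) ψ) :
    ∀ᵐ z ∂ρ, IsBackwardOrbit α (past V ψ z) := by
  have hV := fun n => (hU.measurePreserving_inv.iterate n).quasiMeasurePreserving
  have h1 : ∀ᵐ z ∂ρ, ∀ n, (ψ (V^[n] z) : ℝ) ∈ Ico (α - 1) α ∧ Irrational (ψ (V^[n] z) : ℝ) := by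
    rw [ae_all_iff]
    exact fun n => (hV n).ae (hψ.measurePreserving.quasiMeasurePreserving.ae
      (ae_intervalMeasure_mem hα))
  have h2 : ∀ᵐ z ∂ρ, ∀ n, U (V (V^[n] z)) = V^[n] z := by
    rw [ae_all_iff]
    exact fun n => (hV n).ae hU.right_inv
  have h3 : ∀ᵐ z ∂ρ, ∀ n, ψ (U (V^[n] z)) = intervalMap hα (ψ (V^[n] z)) := by
    rw [ae_all_iff]
    exact fun n => (hV n).ae hψ.semiconj
  filter_upwards [h1, h2, h3] with z h1 h2 h3
  refine ⟨fun n => (h1 n).1, fun n => (h1 n).2, fun n => ?_⟩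
  have h := h3 (n + 1)
  rw [Function.iterate_succ_apply', h2] at h
  rw [past, past, h, Function.iterate_succ_apply']
  rfl

theorem measurable_factor_iterate {α : ℝ} (hα : α ∈ Ioc (0 : ℝ) 1) (hU : IsAEInverse ρ U V)
    {ψ : Z → interval α} (hψ : IsFactorMap U ρ (intervalMap hα) (intervalMeasure α) ψ) (n : ℕ) :
    Measurable fun z => ψ (V^[n] z) :=
  hψ.measurePreserving.measurable.comp (hU.measurePreserving_inv.measurable.iterate n)

/-- The law of the limit point is a weak limit that depends only on `ν_α`. -/
theorem tendsto_integral_limitPoint {α : ℝ} (hα : α ∈ Ioc (0 : ℝ) 1) [IsProbabilityMeasure ρ]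
    (hU : IsAEInverse ρ U V) {ψ : Z → interval α}
    (hψ : IsFactorMap U ρ (intervalMap hα) (intervalMeasure α) ψ)
    (g : BoundedContinuousFunction (ℝ × ℝ) ℝ) :
    Tendsto (fun n => ∫ x : interval α, g ((planarMap α)^[n] (x, 0)) ∂intervalMeasure α) atTop
      (𝓝 (∫ z, g (limitPoint α (past V ψ z)) ∂ρ)) := by
  have hmeas : ∀ n, Measurable fun x : interval α => g ((planarMap α)^[n] (x, 0)) := fun n =>
    g.continuous.measurable.comp (((measurable_planarMap α).iterate n).comp
      (measurable_subtype_coe.prodMk measurable_const))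
  have hint : ∀ n, ∫ x : interval α, g ((planarMap α)^[n] (x, 0)) ∂intervalMeasure α
      = ∫ z, g (approx α (past V ψ z) n) ∂ρ := by
    intro n
    have hmp := hψ.measurePreserving.comp (hU.measurePreserving_inv.iterate n)
    rw [← hmp.map_eq, integral_map hmp.measurable.aemeasurable
      (hmeas n).aestronglyMeasurable]
    rfl
  simp only [hint]
  refine tendsto_integral_of_dominated_convergence (fun _ => ‖g‖) (fun n => ?_)
    (integrable_const _) (fun n => Eventually.of_forall fun z => g.norm_coe_le_norm _) ?_
  · exact (g.continuous.measurable.comp ((measurable_approx α n).comp (measurable_past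
      (measurable_factor_iterate hα hU hψ)))).aestronglyMeasurable
  · filter_upwards [ae_isBackwardOrbit hα hU hψ] with z hz
    exact (g.continuous.tendsto _).comp (hz.tendsto hα)

/-- The points `R^n p` form a planar backward orbit above the past of `p`, so `limitPoint_eq`
applies. -/
theorem limitPoint_past_proj {α : ℝ} (hα : α ∈ Ioc (0 : ℝ) 1) {R : domain α → domain α}
    (hR : IsAEInverse (domainMeasure α) (domainMap α) R) :
    ∀ᵐ p ∂domainMeasure α, limitPoint α (past R (proj hα) p) = p := by
  have hV := fun n => (hR.measurePreserving_inv.iterate n).quasiMeasurePreserving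
  have h2 : ∀ᵐ p ∂domainMeasure α, ∀ n, domainMap α (R (R^[n] p)) = R^[n] p := by
    rw [ae_all_iff]
    exact fun n => (hV n).ae hR.right_inv
  have h3 : ∀ᵐ p ∂domainMeasure α, ∀ n,
      (domainMap α (R^[n] p) : ℝ × ℝ) = planarMap α (R^[n] p) := by
    rw [ae_all_iff]
    exact fun n => (hV n).ae (ae_domainMap_val hα)
  filter_upwards [ae_isBackwardOrbit hα hR (isFactorMap_proj hα), h2, h3] with p h1 h2 h3
  refine h1.limitPoint_eq hα (p := fun n => (R^[n] p : domain α)) (fun n => rfl)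
    (fun n => (domain_subset hα (R^[n] p).2).2) fun n => ?_
  rw [← h3 (n + 1), Function.iterate_succ_apply', h2]

/-- The same sequence of integrals against `ν_α` converges to the integral over `Z` and to the one
over `Ω_α`, and on `Ω_α` the limit point is the point itself. -/
theorem map_limitPoint_past {α : ℝ} (hα : α ∈ Ioc (0 : ℝ) 1) [IsProbabilityMeasure ρ]
    (hU : IsAEInverse ρ U V) {ψ : Z → interval α}
    (hψ : IsFactorMap U ρ (intervalMap hα) (intervalMeasure α) ψ) :
    ρ.map (fun z => limitPoint α (past V ψ z)) = planeProb α := by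
  have := isProbabilityMeasure_domainMeasure hα
  have := isProbabilityMeasure_planeProb hα
  obtain ⟨R, hR⟩ := exists_isAEInverse_domainMap hα
  have hm := measurable_limitPoint_past (measurable_factor_iterate hα hU hψ)
  have := Measure.isProbabilityMeasure_map (μ := ρ) hm.aemeasurable
  refine ext_of_forall_integral_eq_of_IsFiniteMeasure fun g => ?_
  rw [integral_map hm.aemeasurable g.continuous.aestronglyMeasurable,
    ← map_val_domainMeasure, integral_map measurable_subtype_coe.aemeasurable
      g.continuous.aestronglyMeasurable,
    tendsto_nhds_unique (tendsto_integral_limitPoint hα hU hψ g)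
      (tendsto_integral_limitPoint hα hR (isFactorMap_proj hα) g)]
  refine integral_congr_ae ?_
  filter_upwards [limitPoint_past_proj hα hR] with p hp
  rw [hp]

theorem exists_factorMap {α : ℝ} (hα : α ∈ Ioc (0 : ℝ) 1) [IsProbabilityMeasure ρ]
    (hU : IsAEInverse ρ U V) {ψ : Z → interval α}
    (hψ : IsFactorMap U ρ (intervalMap hα) (intervalMeasure α) ψ) :
    ∃ φ : Z → domain α, IsFactorMap U ρ (domainMap α) (domainMeasure α) φ ∧
      ∀ᵐ z ∂ρ, proj hα (φ z) = ψ z := by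
  have he := MeasurableEmbedding.subtype_coe (measurableSet_domain α)
  have hm := measurable_limitPoint_past (measurable_factor_iterate hα hU hψ)
  -- A measurable retraction onto `Ω_α`; its values off `Ω_α` are irrelevant, since limit points lie
  -- in `Ω_α` almost surely.
  obtain ⟨r, hr, hrv⟩ := he.exists_measurable_extend (g := id) measurable_id fun _ =>
    (surjective_proj hα ⟨α, by constructor <;> linarith⟩).nonempty
  have hr' : ∀ q (hq : q ∈ domain α), r q = ⟨q, hq⟩ := fun q hq => congr_fun hrv ⟨q, hq⟩
  have hrm : Measurable fun z => r (limitPoint α (past V ψ z)) := hr.comp hm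
  have hae := ae_isBackwardOrbit hα hU hψ
  have hval : ∀ᵐ z ∂ρ, (r (limitPoint α (past V ψ z)) : ℝ × ℝ) = limitPoint α (past V ψ z) := by
    filter_upwards [hae] with z hz
    rw [hr' _ (hz.limitPoint_mem hα)]
  refine ⟨fun z => r (limitPoint α (past V ψ z)), ⟨⟨hrm, ?_⟩, ?_⟩, ?_⟩
  · rw [← he.comap_map (Measure.map _ ρ), ← he.comap_map (domainMeasure α),
      Measure.map_map he.measurable hrm, map_val_domainMeasure]
    congr 1
    rw [← map_limitPoint_past hα hU hψ]
    exact Measure.map_congr hval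
  · have hU' := hU.measurePreserving.quasiMeasurePreserving
    have hinv : ∀ᵐ z ∂ρ, ∀ n, V^[n] (V (U z)) = V^[n] z := by
      filter_upwards [hU.left_inv] with z hz n
      rw [hz]
    filter_upwards [hae, hU'.ae hae, hinv] with z h1 h2 h3
    -- The past of `U z` is the past of `z` with one newer point in front, which corresponds to one
    -- application of `𝒯_α`.
    have hpast : (fun n => past V ψ (U z) (n + 1)) = past V ψ z := by
      funext n
      rw [past, Function.iterate_succ_apply, h3, past]
    have h4 := IsBackwardOrbit.planarMap_limitPoint hα (x := past V ψ (U z)) (by rwa [hpast]) h2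
    rw [hpast] at h4
    rw [hr' _ (h1.limitPoint_mem hα), hr' _ (h2.limitPoint_mem hα)]
    apply Subtype.ext
    rw [domainMap_val (by rw [h4]; exact h2.limitPoint_mem hα), h4]
  · filter_upwards [hval] with z hz
    apply Subtype.ext
    change (r (limitPoint α (past V ψ z)) : ℝ × ℝ).1 = _
    rw [hz]
    rfl

end Extension

theorem exists_generating_inverse {α : ℝ} (hα : α ∈ Ioc (0 : ℝ) 1) :
    ∃ R : domain α → domain α, IsAEInverse (domainMeasure α) (domainMap α) R ∧
      ∀ A : Set (domain α), MeasurableSet A → ∃ B : Set (domain α),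
        MeasurableSet[⨆ n : ℕ, MeasurableSpace.comap (fun x => proj hα (R^[n] x)) inferInstance] B ∧
          B =ᵐ[domainMeasure α] A := by
  obtain ⟨R, hR⟩ := exists_isAEInverse_domainMap hα
  refine ⟨R, hR, ?_⟩
  rintro _ ⟨A, hA, rfl⟩
  -- The limit point depends only on the past and equals `p` almost everywhere, so pulling `A` back
  -- along it changes `A` only by a null set.
  refine ⟨(fun p => limitPoint α (past R (proj hα) p)) ⁻¹' A, ?_, ?_⟩
  · refine measurable_limitPoint_past
      (m := ⨆ n : ℕ, MeasurableSpace.comap (fun x => proj hα (R^[n] x)) inferInstance)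
      (fun n => ?_) hA
    exact Measurable.of_comap_le (le_iSup (fun n : ℕ =>
      MeasurableSpace.comap (fun x => proj hα (R^[n] x)) inferInstance) n)
  · filter_upwards [limitPoint_past_proj hα hR] with p hp
    apply propext
    change limitPoint α (past R (proj hα) p) ∈ A ↔ (p : ℝ × ℝ) ∈ A
    rw [hp]

theorem isNaturalExtension {α : ℝ} (hα : α ∈ Ioc (0 : ℝ) 1) :
    IsNaturalExtension.{0, 0, u} (domainMap α) (domainMeasure α) (intervalMap hα)
      (intervalMeasure α) (proj hα) where
  prob_top := isProbabilityMeasure_domainMeasure hα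
  prob_base := by
    have := isProbabilityMeasure_domainMeasure hα
    rw [← map_proj_domainMeasure hα]
    exact Measure.isProbabilityMeasure_map (measurable_proj hα).aemeasurable
  base := (isFactorMap_proj hα).base_measurePreserving (measurePreserving_domainMap hα)
    (measurable_intervalMap hα)
  surjective := surjective_proj hα
  factor := isFactorMap_proj hα
  generates := exists_generating_inverse hα
  universal := fun _ _ _ _ _ _ _ hU hψ => exists_factorMap hα hU hψ

end AlphaCF

theorem theoremt (α : ℝ) (hα : α ∈ Set.Ioc (0 : ℝ) 1) :
    (∀ᵐ p ∂(AlphaCF.planeMeasure.restrict (AlphaCF.domain α)),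
      AlphaCF.planarMap α p ∈ AlphaCF.domain α) ∧
    IsNaturalExtension.{0, 0, u}
      (AlphaCF.domainMap α) (AlphaCF.domainMeasure α)
      (AlphaCF.intervalMap hα) (AlphaCF.intervalMeasure α)
      (AlphaCF.proj hα) :=
  ⟨(AlphaCF.ae_mem_core hα).mono fun _ hp => hp.2.2, AlphaCF.isNaturalExtension hα⟩
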